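/- **Theorem 4.4 (sharp Gårding inequality for Wick operators).** Let $d\in\mathbb N$. For $z,w\in\mathbb C^d$ put $\langle z\rangle=(1+|z|^2)^{1/2}$ and $(z,w)=\sum_j z_j\overline{w_j}$, let $d\lambda$ be Lebesgue measure on $\mathbb C^d$ and $d\mu(z)=\pi^{-d}e^{-|z|^2}\,d\lambda(z)$. Let $A^2(\mathbb C^d)$ be the space of entire functions $F$ that are square integrable with respect to $\mu$, with scalar product $(F,G)_{A^2}=\int F\,\overline G\,d\mu$ and norm $\|F\|_{A^2}=(F,F)_{A^2}^{1/2}$. The Bargmann transform of a Schwartz function $f\in\mathscr S(\mathbb R^d)$ is $$\mathfrak V_df(z)=\pi^{-d/4}\int_{\mathbb R^d}\exp\Big(-\tfrac12\Big(\sum_j z_j^2+|y|^2\Big)+\sqrt2\,\sum_j z_jy_j\Big)f(y)\,dy,\qquad z\in\mathbb C^d.$$ For $\rho>0$ and a weight $\omega>0$ on $\mathbb C^d\simeq\mathbb R^{2d}$, let $\wideparen{\mathcal A}^{(\omega)}_{\mathrm{Sh},\rho}(\mathbb C^{2d})$ be the set of all functions $a$ on $\mathbb C^d\times\mathbb C^d$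 such that $(z,w)\mapsto a(z,\overline w)$ is analytic on $\mathbb C^d\times\mathbb C^d$ and such that for all multi-indices $\alpha,\beta\in\mathbb N^d$ and every integer $N\ge0$ there is a constant $C_{\alpha,\beta,N}$ with $$|\partial_z^\alpha\overline\partial_w^\beta a(z,w)|\le C_{\alpha,\beta,N}\,e^{\frac12|z-w|^2}\,\omega(\sqrt2\,\overline z)\,\langle z+w\rangle^{-\rho|\alpha+\beta|}\,\langle z-w\rangle^{-N},\qquad z,w\in\mathbb C^d.$$ The Wick operator with symbol $a$ is $$\mathrm{Op}_{\mathfrak V}(a)F(z)=\pi^{-d}\int_{\mathbb C^d}a(z,w)F(w)e^{(z-w,w)}\,d\lambda(w).$$ Let $\rho>0$, let $\omega(z)=\langle z\rangle^{2\rho}$, and let $a_0\in\wideparen{\mathcal A}^{(\omega)}_{\mathrm{Sh},\rho}(\mathbb C^{2d})$ be such that, for some constant $C_0\ge0$, $a_0(w,w)$ is real and $a_0(w,w)\ge-C_0$ for all $w\in\mathbb C^d$. Then for every $F\in\mathfrak V_d(\mathscr S(\mathbb R^d))$ one has $F\in A^2(\mathbb C^d)$, the integral defining $\mathrm{Op}_{\mathfrak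 V}(a_0)F(z)$ converges absolutely for every $z\in\mathbb C^d$, and $\mathrm{Op}_{\mathfrak V}(a_0)F\in A^2(\mathbb C^d)$. Moreover there is a constant $C\ge0$ such that, for all $F\in\mathfrak V_d(\mathscr S(\mathbb R^d))$, $$\operatorname{Re}\big((\mathrm{Op}_{\mathfrak V}(a_0)F,F)_{A^2}\big)\ge-C\|F\|_{A^2}^2 \qquad\text{and}\qquad \big|\operatorname{Im}\big((\mathrm{Op}_{\mathfrak V}(a_0)F,F)_{A^2}\big)\big|\le C\|F\|_{A^2}^2 .$$ -/

import Mathlib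

open MeasureTheory
open scoped SchwartzMap

noncomputable section

namespace WickCalculus

/-- `ℂ^d` with its Euclidean norm; `volume` is Lebesgue measure. -/
abbrev Cd (d : ℕ) : Type := EuclideanSpace ℂ (Fin d)

/-- The Japanese bracket `⟨x⟩ = (1 + |x|²)^{1/2}`. -/
def bracket {E : Type*} [NormedAddCommGroup E] (x : E) : ℝ :=
  Real.sqrt (1 + ‖x‖ ^ 2)

/-- Componentwise complex conjugation on `ℂ^d`. -/
def conjVec {d : ℕ} (z : Cd d) : Cd d :=
  WithLp.toLp 2 (fun j => (starRingEnd ℂ) (z j))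

/-- The scalar product `(z, w) = ∑ z_j \bar w_j` on `ℂ^d`, linear in the first argument. -/
def scal {d : ℕ} (z w : Cd d) : ℂ :=
  ∑ j, z j * (starRingEnd ℂ) (w j)

/-! ### Wirtinger derivatives -/

/-- The Wirtinger derivative `∂_{z_j} = (∂_{x_j} - i ∂_{y_j}) / 2`. -/
def wirtinger {d : ℕ} (j : Fin d) (f : Cd d → ℂ) : Cd d → ℂ := fun z =>
  (1 / 2 : ℂ) * (fderiv ℝ f z (EuclideanSpace.single j 1)
    - Complex.I * fderiv ℝ f z (EuclideanSpace.single j Complex.I))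

/-- The conjugate Wirtinger derivative `∂̄_{z_j} = (∂_{x_j} + i ∂_{y_j}) / 2`. -/
def wirtingerBar {d : ℕ} (j : Fin d) (f : Cd d → ℂ) : Cd d → ℂ := fun z =>
  (1 / 2 : ℂ) * (fderiv ℝ f z (EuclideanSpace.single j 1)
    + Complex.I * fderiv ℝ f z (EuclideanSpace.single j Complex.I))

/-- `∂_z^α = ∂_{z_1}^{α_1} ⋯ ∂_{z_d}^{α_d}` for a multi-index `α`. -/
def wirtingerPow {d : ℕ} (α : Fin d → ℕ) (f : Cd d → ℂ) : Cd d → ℂ :=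
  (List.finRange d).foldr (fun j g => (wirtinger j)^[α j] g) f

/-- `∂̄_z^β = ∂̄_{z_1}^{β_1} ⋯ ∂̄_{z_d}^{β_d}` for a multi-index `β`. -/
def wirtingerBarPow {d : ℕ} (β : Fin d → ℕ) (f : Cd d → ℂ) : Cd d → ℂ :=
  (List.finRange d).foldr (fun j g => (wirtingerBar j)^[β j] g) f

/-- The mixed derivative `∂_z^α ∂̄_w^β a (z, w)`. -/
def mixedDeriv {d : ℕ} (α β : Fin d → ℕ) (a : Cd d → Cd d → ℂ) (z w : Cd d) : ℂ :=
  wirtingerPow α (fun z' => wirtingerBarPow β (fun w' => a z' w') w) z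

/-! ### Symbols -/

/-- `a` is analytic in `z` and antianalytic in `w`, jointly:
`(z, w) ↦ a (z, \bar w)` is analytic on `ℂ^d × ℂ^d`. -/
def IsWickSymbol {d : ℕ} (a : Cd d → Cd d → ℂ) : Prop :=
  AnalyticOnNhd ℂ (fun p : Cd d × Cd d => a p.1 (conjVec p.2)) Set.univ

/-- The Shubin-type class of Wick symbols of type `ρ` with weight `ω` on `ℂ^d ≃ ℝ^{2d}`:
for all multi-indices `α, β` and all `N ≥ 0` there is a constant `C` such that, on all of
`ℂ^d × ℂ^d`,
`|∂_z^α ∂̄_w^β a (z,w)| ≤ C e^{|z-w|²/2} ω(√2 \bar z) ⟨z+w⟩^{-ρ|α+β|} ⟨z-w⟩^{-N}`. -/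
def ShubinWickClass (d : ℕ) (ρ : ℝ) (ω : Cd d → ℝ) : Set (Cd d → Cd d → ℂ) :=
  {a | IsWickSymbol a ∧
    ∀ (α β : Fin d → ℕ) (N : ℕ), ∃ C : ℝ, ∀ z w : Cd d,
      ‖mixedDeriv α β a z w‖ ≤
        C * Real.exp (‖z - w‖ ^ 2 / 2) * ω (Real.sqrt 2 • conjVec z)
          * bracket (z + w) ^ (-(ρ * (∑ j, ((α j + β j : ℕ) : ℝ))))
          * bracket (z - w) ^ (-(N : ℝ))}

/-! ### The Wick operator -/

/-- The integrand `a(z,w) F(w) e^{(z-w,w)}` of the Wick operator at the point `z`. -/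
def wickIntegrand {d : ℕ} (a : Cd d → Cd d → ℂ) (F : Cd d → ℂ) (z w : Cd d) : ℂ :=
  a z w * F w * Complex.exp (scal (z - w) w)

/-- The Wick operator `Op_𝔙(a) F (z) = π^{-d} ∫ a(z,w) F(w) e^{(z-w,w)} dλ(w)`. -/
def wickOp {d : ℕ} (a : Cd d → Cd d → ℂ) (F : Cd d → ℂ) : Cd d → ℂ := fun z =>
  ((Real.pi ^ (-(d : ℝ)) : ℝ) : ℂ) * ∫ w : Cd d, wickIntegrand a F z w

/-! ### The Fock space `A²(ℂ^d)` -/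

/-- The Gaussian measure `dμ(z) = π^{-d} e^{-|z|²} dλ(z)` on `ℂ^d`. -/
def fockMeasure (d : ℕ) : Measure (Cd d) :=
  (volume : Measure (Cd d)).withDensity
    (fun z => ENNReal.ofReal (Real.pi ^ (-(d : ℝ)) * Real.exp (-‖z‖ ^ 2)))

/-- `F` belongs to `A²(ℂ^d)`: it is entire and square integrable with respect to `μ`. -/
def MemFock {d : ℕ} (F : Cd d → ℂ) : Prop :=
  Differentiable ℂ F ∧ MemLp F 2 (fockMeasure d)

/-- The scalar product `(F, G)_{A²} = ∫ F \bar G dμ`. -/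
def fockInner {d : ℕ} (F G : Cd d → ℂ) : ℂ :=
  ∫ z, F z * (starRingEnd ℂ) (G z) ∂(fockMeasure d)

/-- The norm `‖F‖_{A²} = (∫ |F|² dμ)^{1/2}`. -/
def fockNorm {d : ℕ} (F : Cd d → ℂ) : ℝ :=
  Real.sqrt (∫ z, ‖F z‖ ^ 2 ∂(fockMeasure d))

/-! ### The Bargmann transform -/

/-- The Bargmann transform
`𝔙_d f (z) = π^{-d/4} ∫ exp (-(⟨z,z⟩ + |y|²)/2 + √2 ⟨z,y⟩) f(y) dy`,
where `⟨z,w⟩ = ∑ z_j w_j` is bilinear. -/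
def bargmann {d : ℕ} (f : EuclideanSpace ℝ (Fin d) → ℂ) : Cd d → ℂ := fun z =>
  ((Real.pi ^ (-(d : ℝ) / 4) : ℝ) : ℂ) *
    ∫ y : EuclideanSpace ℝ (Fin d),
      Complex.exp (-(1 / 2 : ℂ) * ((∑ j, z j * z j) + ((‖y‖ ^ 2 : ℝ) : ℂ))
        + ((Real.sqrt 2 : ℝ) : ℂ) * ∑ j, z j * ((y j : ℝ) : ℂ)) * f y

/-- `𝔙_d (𝓢(ℝ^d))`, the image of the Schwartz space under the Bargmann transform. -/
def bargmannSchwartz (d : ℕ) : Set (Cd d → ℂ) :=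
  Set.range (fun f : 𝓢(EuclideanSpace ℝ (Fin d), ℂ) => bargmann (f : _ → ℂ))

end WickCalculus

end

/-!
# Sharp Gårding inequality for Wick operators

On the Fock space the Wick operator with symbol `a(z,w)` has the integral kernel
`a(z,w) e^{(z,w)}`. A symbol that depends on `w` only gives a Toeplitz operator, and by the
reproducing formula (`RapidFock.reproducing`) the form of that operator is `∫ b(w) |F(w)|² dμ(w)`
(`TemperateKernel.toeplitz`). So the Toeplitz operator with symbol `a(w,w)` satisfies the inequality
with the constant `C₀` and without imaginary part, and it remains to see that it differs from the
Wick operator by a bounded form (`GardingSymbol.norm_fockInner_sub_toeplitz_le`).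

Expand `a(·,w)` to first order at `w`.

* The linear term `∑ (z_j - w_j) ∂_{z_j} a(w,w)` is transformed by integration by parts: since
  `(z_j - w_j) e^{(z-w,w)} = ∂̄_{w_j} e^{(z-w,w)}` and `F` is holomorphic, it defines the same
  operator as the Toeplitz symbol `-∑ ∂_{z_j} ∂̄_{w_j} a(w,w)` (`GardingSymbol.linear_term`). Two
  derivatives cancel the weight `⟨·⟩^{2ρ}`, so this symbol is bounded.
* The remainder is governed by second derivatives of `a` on the segment from `w` to `z`, where again
  the weight is cancelled up to powers of `⟨z-w⟩`. It is bounded by `e^{|z-w|²/2} ⟨z-w⟩^{-N}` for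
  every `N` (`GardingSymbol.norm_taylorRemainder_le`). After conjugation with `e^{|·|²/2}` the
  factor `e^{(z-w,w)}` has modulus `e^{-|z-w|²/2}`, which leaves a kernel to which Schur's test
  applies (`TemperateKernel.norm_fockInner_le`).

All integrals converge absolutely because the Bargmann transform of a Schwartz function is entire
and decays, after conjugation with the Gaussian, faster than every power of `⟨z⟩`
(`rapidFock_of_mem_bargmannSchwartz`). By Peetre's inequality Wick operators preserve this space
(`GardingSymbol.rapidFock_wickOp`).
-/

namespace WickCalculus

/-! ### The Japanese bracket -/

section Bracket

variable {E : Type*} [NormedAddCommGroup E]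

theorem bracket_sq (x : E) : bracket x ^ 2 = 1 + ‖x‖ ^ 2 :=
  Real.sq_sqrt (by positivity)

theorem one_le_bracket (x : E) : 1 ≤ bracket x :=
  Real.one_le_sqrt.mpr (by nlinarith [sq_nonneg ‖x‖])

theorem bracket_pos (x : E) : 0 < bracket x := one_pos.trans_le (one_le_bracket x)

theorem bracket_zero : bracket (0 : E) = 1 := by simp [bracket]

theorem bracket_neg (x : E) : bracket (-x) = bracket x := by simp [bracket]

theorem norm_le_bracket (x : E) : ‖x‖ ≤ bracket x :=
  Real.le_sqrt_of_sq_le (by linarith)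

theorem bracket_le_one_add_norm (x : E) : bracket x ≤ 1 + ‖x‖ :=
  Real.sqrt_le_iff.mpr ⟨by positivity, by nlinarith [norm_nonneg x]⟩

/-- A form of Peetre's inequality. -/
theorem bracket_add_le (x y : E) : bracket (x + y) ≤ 2 * (bracket x * bracket y) := by
  have hx := bracket_pos x
  have hy := bracket_pos y
  refine (sq_le_sq₀ (bracket_pos _).le (by positivity)).mp ?_
  rw [mul_pow, mul_pow, bracket_sq, bracket_sq, bracket_sq]
  have h : ‖x + y‖ ^ 2 ≤ (‖x‖ + ‖y‖) ^ 2 := by gcongr; exact norm_add_le x y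
  nlinarith [sq_nonneg (‖x‖ - ‖y‖), mul_nonneg (sq_nonneg ‖x‖) (sq_nonneg ‖y‖)]

theorem bracket_pow_le (N : ℕ) (x y : E) :
    bracket x ^ N ≤ 2 ^ N * (bracket y ^ N * bracket (x - y) ^ N) := by
  rw [← mul_pow, ← mul_pow]
  have h := bracket_add_le y (x - y)
  rw [add_sub_cancel] at h
  exact pow_le_pow_left₀ (bracket_pos x).le h N

theorem integrable_inv_bracket_pow [NormedSpace ℝ E] [FiniteDimensional ℝ E] [MeasurableSpace E]
    [BorelSpace E] {ν : Measure E} [ν.IsAddHaarMeasure] {N : ℕ} (hN : Module.finrank ℝ E < N) :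
    Integrable (fun x : E => (bracket x ^ N)⁻¹) ν := by
  have h := integrable_rpow_neg_one_add_norm_sq (E := E) (μ := ν) (r := N) (by exact_mod_cast hN)
  refine h.congr (Filter.Eventually.of_forall fun x => ?_)
  simp only
  rw [← bracket_sq, ← Real.rpow_natCast (bracket x) 2, ← Real.rpow_mul (bracket_pos x).le,
    ← Real.rpow_natCast, ← Real.rpow_neg (bracket_pos x).le]
  congr 1
  push_cast
  ring

end Bracket

variable {d : ℕ}

/-- An exponent for which `⟨z⟩^{-N}` is integrable on `ℂ^d`. -/
abbrev decayExp (d : ℕ) : ℕ := 2 * d + 1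

theorem finrank_real_Cd (d : ℕ) : Module.finrank ℝ (Cd d) = 2 * d := by
  rw [← Module.finrank_mul_finrank ℝ ℂ (Cd d)]
  simp

theorem integrable_inv_bracket_decayExp :
    Integrable (fun z : Cd d => (bracket z ^ decayExp d)⁻¹) :=
  integrable_inv_bracket_pow (by rw [finrank_real_Cd]; exact Nat.lt_succ_self _)

/-! ### The Gaussian kernel and the Fock space -/

theorem scal_eq_inner (z w : Cd d) : scal z w = inner ℂ w z := by
  simp [scal, PiLp.inner_apply]

/-- The exponential in the Wick operator is a Gaussian in `z - w` after conjugation by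
`e^{|·|²/2}`. -/
theorem norm_exp_scal (z w : Cd d) :
    ‖Complex.exp (scal (z - w) w)‖
      = Real.exp (‖z‖ ^ 2 / 2) * Real.exp (-(‖w‖ ^ 2 / 2)) * Real.exp (-(‖z - w‖ ^ 2 / 2)) := by
  rw [Complex.norm_exp, ← Real.exp_add, ← Real.exp_add]
  congr 1
  have h := norm_add_sq (𝕜 := ℂ) w (z - w)
  rw [add_sub_cancel, ← scal_eq_inner] at h
  simp only [RCLike.re_to_complex] at h
  linarith

theorem continuous_scal : Continuous fun p : Cd d × Cd d => scal p.1 p.2 := by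
  simp_rw [scal_eq_inner]; fun_prop

/-- The density `π^{-d} e^{-|z|²}` of the measure of the Fock space. -/
noncomputable def fockDensity (z : Cd d) : ℝ := Real.pi ^ (-(d : ℝ)) * Real.exp (-‖z‖ ^ 2)

theorem fockDensity_nonneg (z : Cd d) : 0 ≤ fockDensity z := by
  unfold fockDensity; positivity

theorem continuous_fockDensity : Continuous (fockDensity : Cd d → ℝ) := by
  unfold fockDensity; fun_prop

theorem integral_fockMeasure {E : Type*} [NormedAddCommGroup E] [NormedSpace ℝ E] (f : Cd d → E) :
    ∫ z, f z ∂(fockMeasure d) = ∫ z, fockDensity z • f z := by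
  unfold fockMeasure
  rw [integral_withDensity_eq_integral_toReal_smul]
  · refine integral_congr_ae (Filter.Eventually.of_forall fun z => ?_)
    change (ENNReal.ofReal (fockDensity z)).toReal • f z = _
    rw [ENNReal.toReal_ofReal (fockDensity_nonneg z)]
  · exact (continuous_fockDensity (d := d)).measurable.ennreal_ofReal
  · exact Filter.Eventually.of_forall fun z => ENNReal.ofReal_lt_top

theorem integrable_fockMeasure_iff {E : Type*} [NormedAddCommGroup E] [NormedSpace ℝ E]
    {f : Cd d → E} :
    Integrable f (fockMeasure d) ↔ Integrable fun z => fockDensity z • f z := by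
  unfold fockMeasure
  rw [integrable_withDensity_iff_integrable_smul']
  · refine integrable_congr (Filter.Eventually.of_forall fun z => ?_)
    change (ENNReal.ofReal (fockDensity z)).toReal • f z = _
    rw [ENNReal.toReal_ofReal (fockDensity_nonneg z)]
  · exact (continuous_fockDensity (d := d)).measurable.ennreal_ofReal
  · exact Filter.Eventually.of_forall fun z => ENNReal.ofReal_lt_top

theorem fockNorm_sq (F : Cd d → ℂ) :
    fockNorm F ^ 2 = ∫ z, fockDensity z * ‖F z‖ ^ 2 := by
  unfold fockNorm
  rw [Real.sq_sqrt (integral_nonneg fun z => by positivity), integral_fockMeasure]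
  rfl

/-! ### Rapidly decaying entire functions -/

/-- Decay of `F e^{-|·|²/2}` faster than every power of `⟨z⟩`. -/
def RapidDecay (F : Cd d → ℂ) : Prop :=
  ∀ N : ℕ, ∃ C : ℝ, 0 ≤ C ∧
    ∀ z, ‖F z‖ ≤ C * Real.exp (‖z‖ ^ 2 / 2) * (bracket z ^ N)⁻¹

/-- Entire functions `F` for which `F e^{-|·|²/2}` decays faster than every power; this is the
Fock-space counterpart of the Schwartz space. -/
structure RapidFock (F : Cd d → ℂ) : Prop where
  differentiable : Differentiable ℂ F
  decay : RapidDecay F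

theorem RapidFock.integrable_sq {F : Cd d → ℂ} (hF : RapidFock F) :
    Integrable fun z => fockDensity z * ‖F z‖ ^ 2 := by
  obtain ⟨C, hC, h⟩ := hF.decay (decayExp d)
  refine ((integrable_inv_bracket_decayExp (d := d)).const_mul
    (Real.pi ^ (-(d : ℝ)) * C ^ 2)).mono' ?_ (Filter.Eventually.of_forall fun z => ?_)
  · exact (continuous_fockDensity.mul
      (hF.differentiable.continuous.norm.pow 2)).aestronglyMeasurable
  · rw [Real.norm_of_nonneg (mul_nonneg (fockDensity_nonneg z) (by positivity))]
    have hb : (bracket z ^ decayExp d)⁻¹ ≤ 1 :=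
      inv_le_one_of_one_le₀ (one_le_pow₀ (one_le_bracket z))
    have hb0 : 0 ≤ (bracket z ^ decayExp d)⁻¹ := by have := bracket_pos z; positivity
    have he : Real.exp (-‖z‖ ^ 2) * Real.exp (‖z‖ ^ 2 / 2) ^ 2 = 1 := by
      rw [sq (Real.exp _), ← Real.exp_add, ← Real.exp_add, ← Real.exp_zero]; congr 1; ring
    calc fockDensity z * ‖F z‖ ^ 2
        ≤ fockDensity z * (C * Real.exp (‖z‖ ^ 2 / 2) * (bracket z ^ decayExp d)⁻¹) ^ 2 := by
          have := fockDensity_nonneg z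
          gcongr
          exact h z
      _ = Real.pi ^ (-(d : ℝ)) * C ^ 2 * (Real.exp (-‖z‖ ^ 2) * Real.exp (‖z‖ ^ 2 / 2) ^ 2)
            * ((bracket z ^ decayExp d)⁻¹ * (bracket z ^ decayExp d)⁻¹) := by
          unfold fockDensity; ring
      _ ≤ Real.pi ^ (-(d : ℝ)) * C ^ 2 * (bracket z ^ decayExp d)⁻¹ := by
          rw [he, mul_one]
          gcongr
          exact mul_le_of_le_one_right hb0 hb

theorem RapidFock.memFock {F : Cd d → ℂ} (hF : RapidFock F) : MemFock F := by
  refine ⟨hF.differentiable, ?_⟩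
  rw [memLp_two_iff_integrable_sq_norm hF.differentiable.continuous.aestronglyMeasurable]
  exact integrable_fockMeasure_iff.mpr hF.integrable_sq

/-! ### Kernels of temperate growth -/

/-- Kernels `k(z,w)` bounded by `e^{|z-w|²/2}` up to powers of `⟨z⟩` and `⟨w⟩`. -/
structure TemperateKernel (k : Cd d → Cd d → ℂ) : Prop where
  continuous : Continuous fun p : Cd d × Cd d => k p.1 p.2
  bound : ∃ (m : ℕ) (C : ℝ), 0 ≤ C ∧
    ∀ z w, ‖k z w‖ ≤ C * Real.exp (‖z - w‖ ^ 2 / 2) * (bracket z ^ m * bracket w ^ m)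

theorem TemperateKernel.add {k l : Cd d → Cd d → ℂ} (hk : TemperateKernel k)
    (hl : TemperateKernel l) : TemperateKernel fun z w => k z w + l z w := by
  refine ⟨hk.continuous.add hl.continuous, ?_⟩
  obtain ⟨m, C, hC, h⟩ := hk.bound
  obtain ⟨n, D, hD, h'⟩ := hl.bound
  refine ⟨m + n, C + D, by positivity, fun z w => (norm_add_le _ _).trans ?_⟩
  have hz := one_le_bracket z
  have hw := one_le_bracket w
  rw [add_mul, add_mul]
  gcongr
  · refine (h z w).trans ?_
    gcongr <;> first | assumption | omega
  · refine (h' z w).trans ?_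
    gcongr <;> first | assumption | omega

theorem TemperateKernel.neg {k : Cd d → Cd d → ℂ} (hk : TemperateKernel k) :
    TemperateKernel fun z w => -k z w := by
  refine ⟨hk.continuous.neg, ?_⟩
  simpa only [norm_neg] using hk.bound

theorem TemperateKernel.sum {ι : Type*} (s : Finset ι) {k : ι → Cd d → Cd d → ℂ}
    (hk : ∀ i ∈ s, TemperateKernel (k i)) : TemperateKernel fun z w => ∑ i ∈ s, k i z w := by
  classical
  induction s using Finset.induction_on with
  | empty => exact ⟨by simpa using continuous_const, 0, 0, le_rfl, by simp⟩
  | insert i s his ih =>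
    simp only [Finset.sum_insert his]
    exact (hk i (Finset.mem_insert_self i s)).add
      (ih fun j hj => hk j (Finset.mem_insert_of_mem hj))

/-- A kernel depending on `w` only, of polynomial growth, is temperate. -/
theorem TemperateKernel.of_right {b : Cd d → ℂ} (hb : Continuous b) {m : ℕ} {C : ℝ} (hC : 0 ≤ C)
    (h : ∀ w, ‖b w‖ ≤ C * bracket w ^ m) : TemperateKernel fun _ w => b w := by
  refine ⟨hb.comp continuous_snd, m, C, hC, fun z w => (h w).trans ?_⟩
  have h1 : 1 ≤ bracket z ^ m := one_le_pow₀ (one_le_bracket z)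
  have h2 : 1 ≤ Real.exp (‖z - w‖ ^ 2 / 2) := Real.one_le_exp (by positivity)
  have h3 := bracket_pos w
  calc C * bracket w ^ m = C * 1 * (1 * bracket w ^ m) := by ring
    _ ≤ _ := by gcongr

theorem norm_apply_le (z : Cd d) (j : Fin d) : ‖z j‖ ≤ ‖z‖ := PiLp.norm_apply_le z j

/-- Multiplying a temperate kernel by a coordinate of `z - w` keeps it temperate. -/
theorem TemperateKernel.coord_mul {k : Cd d → Cd d → ℂ} (hk : TemperateKernel k) (j : Fin d) :
    TemperateKernel fun z w => (z - w) j * k z w := by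
  obtain ⟨m, C, hC, h⟩ := hk.bound
  have hc := hk.continuous
  refine ⟨by simp only [PiLp.sub_apply]; fun_prop, m + 1, 2 * C, by positivity, fun z w => ?_⟩
  have hz := bracket_pos z
  have hw := bracket_pos w
  have h1 : ‖(z - w) j‖ ≤ 2 * (bracket z * bracket w) :=
    (norm_apply_le _ j).trans ((norm_le_bracket _).trans (by
      simpa only [sub_eq_add_neg, bracket_neg] using bracket_add_le z (-w)))
  rw [norm_mul]
  calc _ ≤ (2 * (bracket z * bracket w))
        * (C * Real.exp (‖z - w‖ ^ 2 / 2) * (bracket z ^ m * bracket w ^ m)) := by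
        gcongr
        exact h z w
    _ = _ := by ring

theorem continuous_wickIntegrand {k : Cd d → Cd d → ℂ} {F : Cd d → ℂ}
    (hk : Continuous fun p : Cd d × Cd d => k p.1 p.2) (hF : Continuous F) :
    Continuous fun p : Cd d × Cd d => wickIntegrand k F p.1 p.2 := by
  unfold wickIntegrand
  have := continuous_scal.comp
    ((continuous_fst.sub continuous_snd).prodMk (continuous_snd (X := Cd d) (Y := Cd d)))
  simp only [Function.comp_def] at this
  fun_prop

theorem norm_wickIntegrand_le (k : Cd d → Cd d → ℂ) {F : Cd d → ℂ} {A B M : ℝ} {z w : Cd d}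
    (hk : ‖k z w‖ ≤ A * Real.exp (‖z - w‖ ^ 2 / 2) * B)
    (hF : ‖F w‖ ≤ M * Real.exp (‖w‖ ^ 2 / 2) * (1 : ℝ)) :
    ‖wickIntegrand k F z w‖ ≤ A * B * M * Real.exp (‖z‖ ^ 2 / 2) := by
  unfold wickIntegrand
  rw [norm_mul, norm_mul, norm_exp_scal]
  have hM := (norm_nonneg _).trans hF
  have hAB := (norm_nonneg _).trans hk
  calc _ ≤ (A * Real.exp (‖z - w‖ ^ 2 / 2) * B) * (M * Real.exp (‖w‖ ^ 2 / 2) * 1)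
        * (Real.exp (‖z‖ ^ 2 / 2) * Real.exp (-(‖w‖ ^ 2 / 2))
          * Real.exp (-(‖z - w‖ ^ 2 / 2))) := by gcongr
    _ = A * B * M * Real.exp (‖z‖ ^ 2 / 2)
        * (Real.exp (‖z - w‖ ^ 2 / 2) * Real.exp (-(‖z - w‖ ^ 2 / 2)))
        * (Real.exp (‖w‖ ^ 2 / 2) * Real.exp (-(‖w‖ ^ 2 / 2))) := by ring
    _ = _ := by rw [← Real.exp_add, ← Real.exp_add]; simp

/-- The integrand of a Wick operator with temperate kernel decays rapidly in `w`. -/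
theorem TemperateKernel.wickIntegrand_bound {k : Cd d → Cd d → ℂ} (hk : TemperateKernel k)
    {F : Cd d → ℂ} (hF : RapidDecay F) :
    ∃ m : ℕ, ∀ N : ℕ, ∃ C : ℝ, 0 ≤ C ∧ ∀ z w, ‖wickIntegrand k F z w‖
      ≤ C * Real.exp (‖z‖ ^ 2 / 2) * bracket z ^ m * (bracket w ^ N)⁻¹ := by
  obtain ⟨m, A, hA, h⟩ := hk.bound
  refine ⟨m, fun N => ?_⟩
  obtain ⟨M, hM, h'⟩ := hF (N + m)
  refine ⟨A * M, by positivity, fun z w => ?_⟩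
  have hw := bracket_pos w
  have := norm_wickIntegrand_le k (F := F) (M := M * (bracket w ^ (N + m))⁻¹) (h z w)
    (by rw [mul_one, mul_right_comm]; exact h' w)
  refine this.trans (le_of_eq ?_)
  rw [pow_add]
  field_simp

theorem TemperateKernel.integrable_wickIntegrand_of_decay {k : Cd d → Cd d → ℂ}
    (hk : TemperateKernel k) {F : Cd d → ℂ} (hm : Measurable F) (hF : RapidDecay F) (z : Cd d) :
    Integrable (wickIntegrand k F z) := by
  obtain ⟨m, h⟩ := hk.wickIntegrand_bound hF
  obtain ⟨C, hC, h⟩ := h (decayExp d)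
  refine ((integrable_inv_bracket_decayExp (d := d)).const_mul
    (C * Real.exp (‖z‖ ^ 2 / 2) * bracket z ^ m)).mono' ?_ (Filter.Eventually.of_forall (h z))
  have hkz : Continuous fun w => k z w := hk.continuous.comp (Continuous.prodMk_right z)
  have hs : Continuous fun w : Cd d => scal (z - w) w :=
    continuous_scal.comp ((continuous_const.sub continuous_id).prodMk continuous_id)
  exact ((hkz.measurable.mul hm).mul
    (Complex.continuous_exp.comp hs).measurable).aestronglyMeasurable

theorem TemperateKernel.integrable_wickIntegrand {k : Cd d → Cd d → ℂ} (hk : TemperateKernel k)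
    {F : Cd d → ℂ} (hF : RapidFock F) (z : Cd d) : Integrable (wickIntegrand k F z) :=
  hk.integrable_wickIntegrand_of_decay hF.differentiable.continuous.measurable hF.decay z

/-- The integrand of the sesquilinear form `(Op(k)F, F)`, as a function on `ℂ^d × ℂ^d`. -/
noncomputable def pairingIntegrand (k : Cd d → Cd d → ℂ) (F : Cd d → ℂ) (z w : Cd d) : ℂ :=
  ((fockDensity z * Real.pi ^ (-(d : ℝ)) : ℝ) : ℂ)
    * (wickIntegrand k F z w * (starRingEnd ℂ) (F z))

theorem continuous_pairingIntegrand {k : Cd d → Cd d → ℂ} {F : Cd d → ℂ}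
    (hk : Continuous fun p : Cd d × Cd d => k p.1 p.2) (hF : Continuous F) :
    Continuous fun p : Cd d × Cd d => pairingIntegrand k F p.1 p.2 := by
  unfold pairingIntegrand
  have h1 := continuous_wickIntegrand hk hF
  have h2 := continuous_fockDensity (d := d)
  have h3 : Continuous fun p : Cd d × Cd d => (starRingEnd ℂ) (F p.1) :=
    Complex.continuous_conj.comp (hF.comp continuous_fst)
  fun_prop

theorem TemperateKernel.integrable_pairingIntegrand {k : Cd d → Cd d → ℂ}
    (hk : TemperateKernel k) {F : Cd d → ℂ} (hF : RapidFock F) :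
    Integrable (Function.uncurry (pairingIntegrand k F)) (volume.prod volume) := by
  obtain ⟨m, h⟩ := hk.wickIntegrand_bound hF.decay
  obtain ⟨C, hC, h⟩ := h (decayExp d)
  obtain ⟨M, hM, h'⟩ := hF.decay (decayExp d + m)
  have hint := (integrable_inv_bracket_decayExp (d := d)).mul_prod
    (integrable_inv_bracket_decayExp (d := d))
  refine (hint.const_mul (Real.pi ^ (-(d : ℝ)) * Real.pi ^ (-(d : ℝ)) * C * M)).mono' ?_
    (Filter.Eventually.of_forall fun p => ?_)
  · exact (continuous_pairingIntegrand hk.continuous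
      hF.differentiable.continuous).aestronglyMeasurable
  · obtain ⟨z, w⟩ := p
    have hz := bracket_pos z
    have hw := bracket_pos w
    have h0 := fockDensity_nonneg z
    simp only [Function.uncurry_apply_pair, pairingIntegrand, norm_mul, RCLike.norm_conj,
      Complex.norm_real]
    rw [Real.norm_of_nonneg h0, Real.norm_of_nonneg (by positivity)]
    have he : Real.exp (-‖z‖ ^ 2) * (Real.exp (‖z‖ ^ 2 / 2) * Real.exp (‖z‖ ^ 2 / 2)) = 1 := by
      rw [← Real.exp_add, ← Real.exp_add, ← Real.exp_zero]; congr 1; ring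
    calc _ ≤ fockDensity z * Real.pi ^ (-(d : ℝ))
          * ((C * Real.exp (‖z‖ ^ 2 / 2) * bracket z ^ m * (bracket w ^ decayExp d)⁻¹)
            * (M * Real.exp (‖z‖ ^ 2 / 2) * (bracket z ^ (decayExp d + m))⁻¹)) := by
          gcongr
          · exact h z w
          · exact h' z
      _ = Real.pi ^ (-(d : ℝ)) * Real.pi ^ (-(d : ℝ)) * C * M
          * ((bracket z ^ decayExp d)⁻¹ * (bracket w ^ decayExp d)⁻¹)
          * (Real.exp (-‖z‖ ^ 2) * (Real.exp (‖z‖ ^ 2 / 2) * Real.exp (‖z‖ ^ 2 / 2))) := by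
          rw [pow_add _ (decayExp d) m, mul_inv, fockDensity]
          field_simp
      _ = _ := by rw [he, mul_one]

theorem fockInner_wickOp (k : Cd d → Cd d → ℂ) (F : Cd d → ℂ) :
    fockInner (wickOp k F) F = ∫ z, ∫ w, pairingIntegrand k F z w := by
  unfold fockInner
  rw [integral_fockMeasure]
  refine integral_congr_ae (Filter.Eventually.of_forall fun z => ?_)
  simp only [pairingIntegrand, wickOp]
  rw [integral_const_mul, integral_mul_const, Complex.real_smul]
  push_cast
  ring

/-- The form `(Op(·)F, F)` is additive on temperate kernels. -/
theorem fockInner_wickOp_add {k l : Cd d → Cd d → ℂ} (hk : TemperateKernel k)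
    (hl : TemperateKernel l) {F : Cd d → ℂ} (hF : RapidFock F) :
    fockInner (wickOp (fun z w => k z w + l z w) F) F
      = fockInner (wickOp k F) F + fockInner (wickOp l F) F := by
  simp only [fockInner_wickOp]
  refine Eq.trans ?_ (integral_integral_add (hk.integrable_pairingIntegrand hF)
    (hl.integrable_pairingIntegrand hF))
  simp only [Function.uncurry_apply_pair, pairingIntegrand, wickIntegrand, add_mul, mul_add]

/-! ### Cauchy estimates and holomorphic parameter integrals -/

section Cauchy

variable {E : Type*} [NormedAddCommGroup E] [NormedSpace ℂ E]

theorem norm_fderiv_apply_le_of_sphere {f : E → ℂ} (hf : Differentiable ℂ f) {z v : E} {r C : ℝ}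
    (hr : 0 < r) (h : ∀ t : ℂ, ‖t‖ = r → ‖f (z + t • v)‖ ≤ C) : ‖fderiv ℂ f z v‖ ≤ C / r := by
  have hg : HasDerivAt (fun t : ℂ => f (z + t • v)) (fderiv ℂ f z v) 0 := by
    have h1 : HasDerivAt (fun t : ℂ => z + t • v) v 0 := by
      simpa using ((hasDerivAt_id (0 : ℂ)).smul_const v).const_add z
    have h2 : HasFDerivAt f (fderiv ℂ f z) (z + (0 : ℂ) • v) := by
      simpa using (hf z).hasFDerivAt
    exact h2.comp_hasDerivAt (0 : ℂ) h1
  rw [← hg.deriv]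
  refine Complex.norm_deriv_le_of_forall_mem_sphere_norm_le hr ?_ fun t ht => h t (by simpa using ht)
  exact Differentiable.diffContOnCl (by fun_prop)

theorem norm_fderiv_le_of_closedBall {f : E → ℂ} (hf : Differentiable ℂ f) {z : E} {r C : ℝ}
    (hr : 0 < r) (h : ∀ y, ‖y - z‖ ≤ r → ‖f y‖ ≤ C) : ‖fderiv ℂ f z‖ ≤ C / r := by
  have hC : 0 ≤ C := (norm_nonneg _).trans (h z (by simpa using hr.le))
  refine ContinuousLinearMap.opNorm_le_bound _ (by positivity) fun v => ?_
  by_cases hv : v = 0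
  · simp [hv]
  have hv' : 0 < ‖v‖ := norm_pos_iff.mpr hv
  refine (norm_fderiv_apply_le_of_sphere hf (r := r / ‖v‖) (C := C) (by positivity)
    fun t ht => h _ ?_).trans (le_of_eq ?_)
  · rw [add_sub_cancel_left, norm_smul, ht, div_mul_cancel₀ _ hv'.ne']
  · field_simp

/-- An integral of entire functions that is locally uniformly dominated is entire. -/
theorem differentiable_integral_of_dominated [FiniteDimensional ℂ E]
    {α : Type*} [TopologicalSpace α] [MeasurableSpace α] [OpensMeasurableSpace α]
    [SecondCountableTopology α]
    {ν : Measure α} {K : E → α → ℂ} (hK : Continuous fun p : E × α => K p.1 p.2)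
    (hd : ∀ a, Differentiable ℂ fun z => K z a)
    (hb : ∀ z₀, ∃ bound : α → ℝ, Integrable bound ν ∧
      ∀ z, ‖z - z₀‖ ≤ 2 → ∀ a, ‖K z a‖ ≤ bound a) :
    Differentiable ℂ fun z => ∫ a, K z a ∂ν := by
  intro z₀
  obtain ⟨bound, hint, hle⟩ := hb z₀
  have : FiniteDimensional ℝ E := FiniteDimensional.complexToReal E
  have : ProperSpace E := FiniteDimensional.proper ℂ E
  have hmeas : ∀ z, AEStronglyMeasurable (K z) ν := fun z =>
    (hK.comp (Continuous.prodMk_right z)).aestronglyMeasurable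
  have hmeas' : AEStronglyMeasurable (fun a => fderiv ℂ (fun z => K z a) z₀) ν := by
    borelize E
    have h := measurable_fderiv_with_param ℂ (f := fun (a : α) (z : E) => K z a)
      (hK.comp continuous_swap)
    exact (h.comp (measurable_prodMk_right (y := z₀))).aestronglyMeasurable
  refine (hasFDerivAt_integral_of_dominated_of_fderiv_le (𝕜 := ℂ) (bound := bound)
    (F' := fun z a => fderiv ℂ (fun z => K z a) z)
    (Metric.ball_mem_nhds z₀ one_pos) (Filter.Eventually.of_forall hmeas)
    (hint.mono' (hmeas z₀) (Filter.Eventually.of_forall fun a => hle z₀ (by simp) a)) hmeas'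
    (Filter.Eventually.of_forall fun a z hz => ?_) hint
    (Filter.Eventually.of_forall fun a z _ => (hd a z).hasFDerivAt)).differentiableAt
  rw [← div_one (bound a)]
  refine norm_fderiv_le_of_closedBall (hd a) one_pos fun y hy => hle y ?_ a
  have : ‖z - z₀‖ < 1 := by simpa [dist_eq_norm] using hz
  calc ‖y - z₀‖ = ‖(y - z) + (z - z₀)‖ := by congr 1; abel
    _ ≤ ‖y - z‖ + ‖z - z₀‖ := norm_add_le _ _
    _ ≤ 2 := by linarith

end Cauchy

/-- Derivatives of rapidly decaying entire functions decay rapidly. The Cauchy estimate is taken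
on a circle of radius `⟨z⟩⁻¹`, on which `e^{|·|²/2}` is comparable to `e^{|z|²/2}`. -/
theorem RapidFock.rapidDecay_fderiv {F : Cd d → ℂ} (hF : RapidFock F) {v : Cd d}
    (hv : ‖v‖ ≤ 1) : RapidDecay fun z => fderiv ℂ F z v := by
  intro N
  obtain ⟨C, hC, h⟩ := hF.decay (N + 1)
  refine ⟨C * Real.exp (3 / 2) * 4 ^ (N + 1), by positivity, fun z => ?_⟩
  have hz := bracket_pos z
  have hz1 := one_le_bracket z
  have key : ∀ t : ℂ, ‖t‖ = (bracket z)⁻¹ → ‖F (z + t • v)‖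
      ≤ C * (Real.exp (3 / 2) * Real.exp (‖z‖ ^ 2 / 2))
        * (4 ^ (N + 1) * (bracket z ^ (N + 1))⁻¹) := by
    intro t ht
    have hti : ‖t‖ * bracket z = 1 := by rw [ht]; field_simp
    have ht1 : ‖t‖ ≤ 1 := by rw [ht]; exact inv_le_one_of_one_le₀ hz1
    have htv : ‖t • v‖ ≤ ‖t‖ := by
      rw [norm_smul]; exact mul_le_of_le_one_right (norm_nonneg _) hv
    have hn : ‖z + t • v‖ ≤ ‖z‖ + ‖t‖ := (norm_add_le _ _).trans (by gcongr)
    have hsq : ‖z + t • v‖ ^ 2 ≤ ‖z‖ ^ 2 + 3 := by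
      have h1 : ‖z + t • v‖ ^ 2 ≤ (‖z‖ + ‖t‖) ^ 2 := by gcongr
      have h2 : ‖t‖ * ‖z‖ ≤ ‖t‖ * bracket z := by
        gcongr; exact norm_le_bracket z
      nlinarith [norm_nonneg t]
    have hb : bracket z ≤ 4 * bracket (z + t • v) := by
      have h1 := bracket_add_le (z + t • v) (-(t • v))
      rw [add_neg_cancel_right, bracket_neg] at h1
      have h2 : bracket (t • v) ≤ 2 := by
        linarith [bracket_le_one_add_norm (t • v)]
      nlinarith [bracket_pos (z + t • v)]
    have hb0 := bracket_pos (z + t • v)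
    refine (h _).trans ?_
    gcongr
    · rw [← Real.exp_add]
      exact Real.exp_le_exp.mpr (by linarith)
    · rw [← inv_inv ((4 : ℝ) ^ (N + 1)), ← mul_inv]
      refine inv_anti₀ (by positivity) ?_
      rw [inv_mul_le_iff₀ (by positivity), ← mul_pow]
      gcongr
  refine (norm_fderiv_apply_le_of_sphere hF.differentiable (inv_pos.mpr hz) key).trans
    (le_of_eq ?_)
  rw [pow_succ (bracket z)]
  field_simp

/-! ### The Bargmann transform of Schwartz functions -/

/-- The Gaussian kernel of the Bargmann transform. -/
noncomputable def bargmannKernel (z : Cd d) (y : EuclideanSpace ℝ (Fin d)) : ℂ :=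
  Complex.exp (-(1 / 2 : ℂ) * ((∑ j, z j * z j) + ((‖y‖ ^ 2 : ℝ) : ℂ))
    + ((Real.sqrt 2 : ℝ) : ℂ) * ∑ j, z j * ((y j : ℝ) : ℂ))

theorem norm_bargmannKernel_le (z : Cd d) (y : EuclideanSpace ℝ (Fin d)) :
    ‖bargmannKernel z y‖ ≤ Real.exp (‖z‖ ^ 2 / 2) := by
  unfold bargmannKernel
  rw [Complex.norm_exp]
  refine Real.exp_le_exp.mpr ?_
  rw [EuclideanSpace.norm_sq_eq, EuclideanSpace.norm_sq_eq]
  have h2 : Real.sqrt 2 ^ 2 = 2 := Real.sq_sqrt zero_le_two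
  have h : ∀ j, -(1 / 2) * ((z j * z j).re + ‖y j‖ ^ 2) + Real.sqrt 2 * ((z j).re * y j)
      ≤ ‖z j‖ ^ 2 / 2 := by
    intro j
    rw [Complex.mul_re, ← Complex.normSq_eq_norm_sq, Complex.normSq_apply, Real.norm_eq_abs,
      sq_abs]
    nlinarith [sq_nonneg (Real.sqrt 2 * (z j).re - y j)]
  have hs := Finset.sum_le_sum fun j (_ : j ∈ Finset.univ) => h j
  rw [Finset.sum_add_distrib, ← Finset.mul_sum, ← Finset.mul_sum, Finset.sum_add_distrib,
    ← Finset.sum_div] at hs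
  refine (le_of_eq ?_).trans hs
  simp only [Complex.add_re, Complex.mul_re, Complex.re_sum, Complex.ofReal_re, Complex.ofReal_im,
    mul_zero, sub_zero, zero_mul, Complex.neg_re, Complex.neg_im, Complex.div_ofNat_re,
    Complex.div_ofNat_im, Complex.one_re, Complex.one_im, neg_zero, zero_div]

theorem continuous_bargmannKernel :
    Continuous fun p : Cd d × EuclideanSpace ℝ (Fin d) => bargmannKernel p.1 p.2 := by
  unfold bargmannKernel; fun_prop

theorem differentiable_bargmannKernel (y : EuclideanSpace ℝ (Fin d)) :
    Differentiable ℂ fun z : Cd d => bargmannKernel z y := by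
  unfold bargmannKernel; fun_prop

theorem integrable_bargmannKernel_mul (f : 𝓢(EuclideanSpace ℝ (Fin d), ℂ)) (z : Cd d) :
    Integrable fun y => bargmannKernel z y * f y := by
  refine (f.integrable (μ := volume)).bdd_mul (c := Real.exp (‖z‖ ^ 2 / 2)) ?_
    (Filter.Eventually.of_forall fun y => norm_bargmannKernel_le z y)
  exact (continuous_bargmannKernel.comp (Continuous.prodMk_right z)).aestronglyMeasurable

theorem bargmann_eq (f : EuclideanSpace ℝ (Fin d) → ℂ) (z : Cd d) :
    bargmann f z
      = ((Real.pi ^ (-(d : ℝ) / 4) : ℝ) : ℂ) * ∫ y, bargmannKernel z y * f y := rfl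

theorem differentiable_bargmann (f : 𝓢(EuclideanSpace ℝ (Fin d), ℂ)) :
    Differentiable ℂ (bargmann (f : _ → ℂ)) := by
  refine Differentiable.const_mul (differentiable_integral_of_dominated
    (K := fun z y => bargmannKernel z y * f y) ?_ (fun y => ?_) fun z₀ => ?_) _
  · have := f.continuous
    have := continuous_bargmannKernel (d := d)
    fun_prop
  · exact (differentiable_bargmannKernel y).mul_const _
  · refine ⟨fun y => Real.exp ((‖z₀‖ + 2) ^ 2 / 2) * ‖f y‖,
      ((f.integrable (μ := volume)).norm).const_mul _, fun z hz y => ?_⟩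
    rw [norm_mul]
    refine mul_le_mul_of_nonneg_right ((norm_bargmannKernel_le z y).trans ?_) (norm_nonneg _)
    have hz' : ‖z‖ ≤ ‖z₀‖ + 2 := ?_
    · exact Real.exp_le_exp.mpr (by gcongr)
    calc ‖z‖ = ‖z₀ + (z - z₀)‖ := by congr 1; abel
      _ ≤ ‖z₀‖ + ‖z - z₀‖ := norm_add_le _ _
      _ ≤ ‖z₀‖ + 2 := by gcongr

/-- The creation operator `y_j - ∂_{y_j}` on the Schwartz space. -/
noncomputable def creation (j : Fin d) (f : 𝓢(EuclideanSpace ℝ (Fin d), ℂ)) :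
    𝓢(EuclideanSpace ℝ (Fin d), ℂ) :=
  SchwartzMap.smulLeftCLM ℂ (fun y : EuclideanSpace ℝ (Fin d) => y j) f
    - LineDeriv.lineDerivOp (EuclideanSpace.single j (1 : ℝ)) f

theorem hasTemperateGrowth_coord (j : Fin d) :
    (fun y : EuclideanSpace ℝ (Fin d) => y j).HasTemperateGrowth :=
  (EuclideanSpace.proj (𝕜 := ℝ) j).hasTemperateGrowth

theorem hasLineDerivAt_bargmannKernel (z : Cd d) (y : EuclideanSpace ℝ (Fin d)) (j : Fin d) :
    HasLineDerivAt ℝ (bargmannKernel z)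
      (bargmannKernel z y * (((Real.sqrt 2 : ℝ) : ℂ) * z j - ((y j : ℝ) : ℂ))) y
      (EuclideanSpace.single j (1 : ℝ)) := by
  have hn : HasDerivAt (fun t : ℝ => ((‖y + t • EuclideanSpace.single j (1 : ℝ)‖ ^ 2 : ℝ) : ℂ))
      ((2 * y j : ℝ) : ℂ) 0 := by
    have h0 : ∀ t : ℝ, ‖y + t • EuclideanSpace.single j (1 : ℝ)‖ ^ 2
        = ‖y‖ ^ 2 + 2 * (t * y j) + t ^ 2 := by
      intro t
      rw [norm_add_sq_real, inner_smul_right, EuclideanSpace.inner_single_right, norm_smul]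
      simp
    simp_rw [h0]
    have h1 : HasDerivAt (fun t : ℝ => ‖y‖ ^ 2 + 2 * (t * y j) + t ^ 2) (2 * y j) 0 := by
      have := ((((hasDerivAt_id (0 : ℝ)).mul_const (y j)).const_mul 2).const_add (‖y‖ ^ 2)).add
        ((hasDerivAt_id (0 : ℝ)).pow 2)
      convert! this using 1
      simp
    exact h1.ofReal_comp
  have hl : HasDerivAt
      (fun t : ℝ => ∑ i, z i * (((y + t • EuclideanSpace.single j (1 : ℝ)) i : ℝ) : ℂ))
      (z j) 0 := by
    have h0 : ∀ t : ℝ, ∑ i, z i * (((y + t • EuclideanSpace.single j (1 : ℝ)) i : ℝ) : ℂ)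
        = ∑ i, z i * ((y i : ℝ) : ℂ) + (t : ℂ) * z j := by
      intro t
      simp only [PiLp.add_apply, PiLp.smul_apply, PiLp.single_apply, smul_eq_mul,
        Complex.ofReal_add, Complex.ofReal_mul, mul_add, Finset.sum_add_distrib]
      congr 1
      rw [Finset.sum_eq_single j]
      · simp [mul_comm]
      · intro i _ hi; simp [hi]
      · simp
    simp_rw [h0]
    have := (((hasDerivAt_id (0 : ℝ)).ofReal_comp.mul_const (z j))).const_add
      (∑ i, z i * ((y i : ℝ) : ℂ))
    simpa using this
  have h := ((((hn.const_add (∑ j, z j * z j)).const_mul (-(1 / 2 : ℂ))).add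
    (hl.const_mul ((Real.sqrt 2 : ℝ) : ℂ)))).cexp
  unfold HasLineDerivAt bargmannKernel
  convert! h using 1
  simp
  ring

/-- The Bargmann transform intertwines creation operators with multiplication by coordinates. -/
theorem bargmann_creation (j : Fin d) (f : 𝓢(EuclideanSpace ℝ (Fin d), ℂ)) (z : Cd d) :
    bargmann (creation j f) z = ((Real.sqrt 2 : ℝ) : ℂ) * z j * bargmann f z := by
  set e : EuclideanSpace ℝ (Fin d) := EuclideanSpace.single j (1 : ℝ)
  set g := SchwartzMap.smulLeftCLM ℂ (fun y : EuclideanSpace ℝ (Fin d) => y j) f with hg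
  have hgy : ∀ y, g y = ((y j : ℝ) : ℂ) * f y := fun y => by
    rw [hg, SchwartzMap.smulLeftCLM_apply_apply (hasTemperateGrowth_coord j), Complex.real_smul]
  have hf := integrable_bargmannKernel_mul f z
  have hg' := integrable_bargmannKernel_mul g z
  have hd := integrable_bargmannKernel_mul (LineDeriv.lineDerivOp e f) z
  have hibp := integral_bilinear_hasLineDerivAt_right_eq_neg_left_of_integrable
    (μ := volume) (v := e) (f := f) (f' := LineDeriv.lineDerivOp e f) (g := bargmannKernel z)
    (g' := fun y => bargmannKernel z y * (((Real.sqrt 2 : ℝ) : ℂ) * z j - ((y j : ℝ) : ℂ)))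
    (B := ContinuousLinearMap.mul ℝ ℂ)
    (hd.congr (Filter.Eventually.of_forall fun y => by simp [mul_comm]))
    (((hf.const_mul (((Real.sqrt 2 : ℝ) : ℂ) * z j)).sub hg').congr
      (Filter.Eventually.of_forall fun y => by simp [hgy]; ring))
    (hf.congr (Filter.Eventually.of_forall fun y => by simp [mul_comm]))
    (fun y _ => by
      rw [SchwartzMap.lineDerivOp_apply]
      exact f.differentiableAt.lineDifferentiableAt.hasLineDerivAt)
    (fun y _ => hasLineDerivAt_bargmannKernel z y j)
  have h1 : ∫ y, bargmannKernel z y * creation j f y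
      = (∫ y, bargmannKernel z y * g y)
        - ∫ y, bargmannKernel z y * LineDeriv.lineDerivOp e f y := by
    rw [← integral_sub hg' hd]
    refine integral_congr_ae (Filter.Eventually.of_forall fun y => ?_)
    simp only [creation, sub_apply, mul_sub]
    rfl
  have h2 : ∫ y, (ContinuousLinearMap.mul ℝ ℂ (f y))
      (bargmannKernel z y * (((Real.sqrt 2 : ℝ) : ℂ) * z j - ((y j : ℝ) : ℂ)))
      = ((Real.sqrt 2 : ℝ) : ℂ) * z j * (∫ y, bargmannKernel z y * f y)
        - ∫ y, bargmannKernel z y * g y := by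
    rw [← integral_const_mul, ← integral_sub (hf.const_mul _) hg']
    refine integral_congr_ae (Filter.Eventually.of_forall fun y => ?_)
    simp [hgy]; ring
  have h3 : ∫ y, (ContinuousLinearMap.mul ℝ ℂ (LineDeriv.lineDerivOp e f y)) (bargmannKernel z y)
      = ∫ y, bargmannKernel z y * LineDeriv.lineDerivOp e f y :=
    integral_congr_ae (Filter.Eventually.of_forall fun y => by simp [mul_comm])
  rw [h2, h3] at hibp
  rw [bargmann_eq, bargmann_eq, h1]
  linear_combination (-((Real.pi ^ (-(d : ℝ) / 4) : ℝ) : ℂ)) * hibp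

theorem norm_le_sum_norm (z : Cd d) : ‖z‖ ≤ ∑ j, ‖z j‖ := by
  rw [EuclideanSpace.norm_eq]
  exact Real.sqrt_le_iff.mpr ⟨Finset.sum_nonneg fun _ _ => norm_nonneg _,
    Finset.sum_sq_le_sq_sum_of_nonneg fun _ _ => norm_nonneg _⟩

/-- Bargmann transforms of Schwartz functions decay rapidly after conjugation with the Gaussian:
each factor of `⟨z⟩` is exchanged for creation operators on the Schwartz side. -/
theorem bargmann_decay (N : ℕ) : ∀ f : 𝓢(EuclideanSpace ℝ (Fin d), ℂ), ∃ C : ℝ, 0 ≤ C ∧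
    ∀ z : Cd d, bracket z ^ N * ‖bargmann f z‖ ≤ C * Real.exp (‖z‖ ^ 2 / 2) := by
  induction N with
  | zero =>
    intro f
    refine ⟨Real.pi ^ (-(d : ℝ) / 4) * ∫ y, ‖f y‖, by positivity, fun z => ?_⟩
    rw [pow_zero, one_mul, bargmann_eq, norm_mul, Complex.norm_real,
      Real.norm_of_nonneg (by positivity), mul_assoc]
    gcongr
    rw [← integral_mul_const]
    refine norm_integral_le_of_norm_le (((f.integrable (μ := volume)).norm).mul_const _)
      (Filter.Eventually.of_forall fun y => ?_)
    rw [norm_mul, mul_comm]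
    gcongr
    exact norm_bargmannKernel_le z y
  | succ N ih =>
    intro f
    obtain ⟨C, hC, h⟩ := ih f
    choose D hD h' using fun j => ih (creation j f)
    refine ⟨C + ∑ j, D j, add_nonneg hC (Finset.sum_nonneg fun j _ => hD j), fun z => ?_⟩
    have hz := bracket_pos z
    have hb : bracket z ≤ 1 + ∑ j, ‖z j‖ :=
      (bracket_le_one_add_norm z).trans (by gcongr; exact norm_le_sum_norm z)
    have hs : (1 : ℝ) ≤ Real.sqrt 2 := Real.one_le_sqrt.mpr one_le_two
    have hj : ∀ j, bracket z ^ N * (‖z j‖ * ‖bargmann f z‖) ≤ D j * Real.exp (‖z‖ ^ 2 / 2) := by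
      intro j
      refine le_trans ?_ (h' j z)
      rw [bargmann_creation, norm_mul, norm_mul, Complex.norm_real,
        Real.norm_of_nonneg (Real.sqrt_nonneg 2)]
      gcongr
      exact le_mul_of_one_le_left (norm_nonneg _) hs
    calc bracket z ^ (N + 1) * ‖bargmann f z‖
        = bracket z ^ N * (bracket z * ‖bargmann f z‖) := by ring
      _ ≤ bracket z ^ N * ((1 + ∑ j, ‖z j‖) * ‖bargmann f z‖) := by gcongr
      _ = bracket z ^ N * ‖bargmann f z‖ + ∑ j, bracket z ^ N * (‖z j‖ * ‖bargmann f z‖) := by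
          rw [← Finset.mul_sum, ← Finset.sum_mul]; ring
      _ ≤ C * Real.exp (‖z‖ ^ 2 / 2) + ∑ j, D j * Real.exp (‖z‖ ^ 2 / 2) :=
          add_le_add (h z) (Finset.sum_le_sum fun j _ => hj j)
      _ = _ := by rw [← Finset.sum_mul]; ring

theorem rapidFock_of_mem_bargmannSchwartz {F : Cd d → ℂ} (hF : F ∈ bargmannSchwartz d) :
    RapidFock F := by
  obtain ⟨f, rfl⟩ := hF
  refine ⟨differentiable_bargmann f, fun N => ?_⟩
  obtain ⟨C, hC, h⟩ := bargmann_decay N f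
  refine ⟨C, hC, fun z => ?_⟩
  have := pow_pos (bracket_pos z) N
  rw [← div_eq_mul_inv, le_div_iff₀ this, mul_comm]
  exact h z

/-! ### Complex conjugation and Wirtinger derivatives -/

theorem conjVec_conjVec (z : Cd d) : conjVec (conjVec z) = z := by
  ext j; simp [conjVec]

/-- Conjugation on `ℂ^d` as a real-linear map. -/
noncomputable def conjCLM (d : ℕ) : Cd d →L[ℝ] Cd d :=
  LinearMap.toContinuousLinearMap
    { toFun := conjVec
      map_add' := fun z w => by ext j; simp [conjVec]
      map_smul' := fun c z => by ext j; simp [conjVec] }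

theorem conjCLM_apply (z : Cd d) : conjCLM d z = conjVec z := rfl

theorem conjVec_smul (c : ℂ) (z : Cd d) : conjVec (c • z) = (starRingEnd ℂ) c • conjVec z := by
  ext j; simp [conjVec]

theorem norm_conjVec (z : Cd d) : ‖conjVec z‖ = ‖z‖ := by
  simp [EuclideanSpace.norm_eq, conjVec]

/-- The `j`-th standard basis vector of `ℂ^d`. -/
noncomputable abbrev stdVec (j : Fin d) : Cd d := EuclideanSpace.single j (1 : ℂ)

theorem norm_stdVec (j : Fin d) : ‖stdVec j‖ = 1 := by simp

theorem conjVec_stdVec (j : Fin d) : conjVec (stdVec j) = stdVec j := by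
  ext i; by_cases h : i = j <;> simp [conjVec, h]

theorem single_I (j : Fin d) :
    EuclideanSpace.single j Complex.I = Complex.I • (stdVec j : Cd d) := by
  ext i; by_cases h : i = j <;> simp [h]

theorem sum_smul_stdVec (z : Cd d) : ∑ j, z j • stdVec j = z := by
  ext i
  simp only [WithLp.ofLp_sum, WithLp.ofLp_smul, Finset.sum_apply, Pi.smul_apply, smul_eq_mul,
    PiLp.single_apply, mul_ite, mul_one, mul_zero]
  simp

theorem wirtinger_eq_of_hasFDerivAt {f : Cd d → ℂ} {z : Cd d} {L M : Cd d →L[ℂ] ℂ}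
    (hf : HasFDerivAt f (L.restrictScalars ℝ + (M.restrictScalars ℝ).comp (conjCLM d)) z)
    (j : Fin d) : wirtinger j f z = L (stdVec j) ∧ wirtingerBar j f z = M (stdVec j) := by
  unfold wirtinger wirtingerBar
  rw [hf.fderiv, single_I]
  simp only [add_apply, ContinuousLinearMap.coe_restrictScalars', ContinuousLinearMap.comp_apply,
    conjCLM_apply, conjVec_smul, conjVec_stdVec, map_smul, smul_eq_mul, Complex.conj_I]
  constructor
  · linear_combination (-(1 / 2) * L (stdVec j) + (1 / 2) * M (stdVec j)) * Complex.I_mul_I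
  · linear_combination ((1 / 2) * L (stdVec j) - (1 / 2) * M (stdVec j)) * Complex.I_mul_I

/-- The chain rule for `w ↦ h(w, \bar w)` with `h` holomorphic. -/
theorem hasFDerivAt_comp_conj {h : Cd d × Cd d → ℂ} (hh : Differentiable ℂ h) (w : Cd d) :
    HasFDerivAt (fun w => h (w, conjVec w))
      (((fderiv ℂ h (w, conjVec w)).comp (ContinuousLinearMap.inl ℂ _ _)).restrictScalars ℝ
        + (((fderiv ℂ h (w, conjVec w)).comp
          (ContinuousLinearMap.inr ℂ _ _)).restrictScalars ℝ).comp (conjCLM d)) w := by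
  have h1 := (hh (w, conjVec w)).hasFDerivAt.restrictScalars ℝ
  have h2 : HasFDerivAt (fun w : Cd d => (w, conjVec w))
      ((ContinuousLinearMap.id ℝ (Cd d)).prod (conjCLM d)) w :=
    (hasFDerivAt_id w).prodMk (conjCLM d).hasFDerivAt
  refine (h1.comp w h2).congr_fderiv ?_
  ext v
  simp [← map_add]

theorem wirtinger_eq {f : Cd d → ℂ} (hf : Differentiable ℂ f) (j : Fin d) (z : Cd d) :
    wirtinger j f z = fderiv ℂ f z (stdVec j) := by
  refine (wirtinger_eq_of_hasFDerivAt (M := 0) ?_ j).1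
  refine ((hf z).hasFDerivAt.restrictScalars ℝ).congr_fderiv ?_
  ext v; simp

theorem wirtingerBar_comp_conj {g : Cd d → ℂ} (hg : Differentiable ℂ g) (j : Fin d) (w : Cd d) :
    wirtingerBar j (fun w => g (conjVec w)) w = fderiv ℂ g (conjVec w) (stdVec j) := by
  refine (wirtinger_eq_of_hasFDerivAt (L := 0) ?_ j).2
  refine (((hg (conjVec w)).hasFDerivAt.restrictScalars ℝ).comp w
    (conjCLM d).hasFDerivAt).congr_fderiv ?_
  ext v; simp

/-! ### Iterated Wirtinger derivatives -/

section Iterate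

variable {X : Type*} (T : Fin d → X → X)

theorem foldr_iterate_zero (l : List (Fin d)) (x : X) :
    l.foldr (fun j g => (T j)^[(0 : Fin d → ℕ) j] g) x = x := by
  induction l with
  | nil => rfl
  | cons i l ih => simp

/-- Raising one exponent in a composition of powers of commuting operators. Commutation is only
needed on an invariant class `P` of arguments. -/
theorem foldr_iterate_add_single (P : X → Prop) (hP : ∀ j x, P x → P (T j x))
    (hT : ∀ i j x, P x → T i (T j x) = T j (T i x)) (α : Fin d → ℕ) (k : Fin d) {x : X}
    (hx : P x) {l : List (Fin d)} (hl : l.Nodup) :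
    l.foldr (fun j g => (T j)^[(α + Pi.single k 1 : Fin d → ℕ) j] g) x
      = if k ∈ l then T k (l.foldr (fun j g => (T j)^[α j] g) x)
        else l.foldr (fun j g => (T j)^[α j] g) x := by
  have hPi : ∀ i n x, P x → P ((T i)^[n] x) := by
    intro i n
    induction n with
    | zero => exact fun x hx => hx
    | succ n ih => exact fun x hx => ih _ (hP i x hx)
  have hPl : ∀ l : List (Fin d), P (l.foldr (fun j g => (T j)^[α j] g) x) := by
    intro l
    induction l with
    | nil => exact hx
    | cons i l ih => exact hPi _ _ _ ih
  have hc : ∀ i n x, P x → (T i)^[n] (T k x) = T k ((T i)^[n] x) := by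
    intro i n
    induction n with
    | zero => exact fun x _ => rfl
    | succ n ih =>
      intro x hx
      rw [Function.iterate_succ_apply, Function.iterate_succ_apply, hT i k x hx,
        ih _ (hP i x hx)]
  induction l with
  | nil => simp
  | cons i l ih =>
    obtain ⟨hil, hl⟩ := List.nodup_cons.mp hl
    simp only [List.foldr_cons, ih hl]
    by_cases hik : k = i
    · subst hik
      simp [hil, Function.iterate_succ_apply']
    · have : (α + Pi.single k 1 : Fin d → ℕ) i = α i := by simp [Ne.symm hik]
      rw [this]
      by_cases hk : k ∈ l
      · simp [hk, hc i _ _ (hPl l)]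
      · simp [hk, hik]

end Iterate

theorem wirtingerPow_zero (f : Cd d → ℂ) : wirtingerPow 0 f = f :=
  foldr_iterate_zero _ _ _

theorem wirtingerBarPow_zero (f : Cd d → ℂ) : wirtingerBarPow 0 f = f :=
  foldr_iterate_zero _ _ _

section DirectionalDerivative

variable {E : Type*} [NormedAddCommGroup E] [NormedSpace ℂ E]

open scoped ContDiff

theorem contDiff_fderiv_apply {f : E → ℂ} (hf : ContDiff ℂ ∞ f) (v : E) :
    ContDiff ℂ ∞ fun p => fderiv ℂ f p v :=
  (hf.fderiv_right (m := ∞) (by simp)).clm_apply contDiff_const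

theorem fderiv_fderiv_apply {f : E → ℂ} (hf : ContDiff ℂ ∞ f) (u v p : E) :
    fderiv ℂ (fun p => fderiv ℂ f p v) p u = fderiv ℂ (fderiv ℂ f) p u v := by
  have h : DifferentiableAt ℂ (fderiv ℂ f) p :=
    (hf.fderiv_right (m := ∞) (by simp)).differentiable (by simp) p
  rw [fderiv_clm_apply h (differentiableAt_const v)]
  simp

theorem fderiv_fderiv_comm {f : E → ℂ} (hf : ContDiff ℂ ∞ f) (u v p : E) :
    fderiv ℂ (fun p => fderiv ℂ f p v) p u = fderiv ℂ (fun p => fderiv ℂ f p u) p v := by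
  rw [fderiv_fderiv_apply hf, fderiv_fderiv_apply hf]
  exact (hf.contDiffAt.isSymmSndFDerivAt (by simpa using ENat.LEInfty.out)).eq u v

end DirectionalDerivative

open scoped ContDiff in
theorem wirtingerPow_add_single {f : Cd d → ℂ} (hf : ContDiff ℂ ∞ f) (α : Fin d → ℕ)
    (k : Fin d) : wirtingerPow (α + Pi.single k 1) f = wirtinger k (wirtingerPow α f) := by
  have hw : ∀ (j : Fin d) (f : Cd d → ℂ), ContDiff ℂ ∞ f →
      wirtinger j f = fun z => fderiv ℂ f z (stdVec j) := fun j f hf =>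
    funext fun z => wirtinger_eq (hf.differentiable (by simp)) j z
  have h := foldr_iterate_add_single (fun j => wirtinger (d := d) j) (fun f => ContDiff ℂ ∞ f)
    (fun j f hf => by rw [hw j f hf]; exact contDiff_fderiv_apply hf _)
    (fun i j f hf => by
      rw [hw j f hf, hw i f hf, hw _ _ (contDiff_fderiv_apply hf _),
        hw _ _ (contDiff_fderiv_apply hf _)]
      exact funext fun z => fderiv_fderiv_comm hf _ _ _) α k hf (List.nodup_finRange d)
  simpa [wirtingerPow] using h

open scoped ContDiff in
theorem wirtingerBarPow_single {g : Cd d → ℂ} (hg : ContDiff ℂ ∞ g) (k : Fin d) :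
    wirtingerBarPow (Pi.single k 1) (fun w => g (conjVec w))
      = wirtingerBar k (fun w => g (conjVec w)) := by
  have hw : ∀ (j : Fin d) (g : Cd d → ℂ), ContDiff ℂ ∞ g →
      wirtingerBar j (fun w => g (conjVec w))
        = fun w => fderiv ℂ g (conjVec w) (stdVec j) := fun j f hf =>
    funext fun z => wirtingerBar_comp_conj (hf.differentiable (by simp)) j z
  have h := foldr_iterate_add_single (fun j => wirtingerBar (d := d) j)
    (fun f => ∃ g : Cd d → ℂ, ContDiff ℂ ∞ g ∧ f = fun w => g (conjVec w))
    (fun j f ⟨g, hg, hfg⟩ => ⟨_, contDiff_fderiv_apply hg (stdVec j), by rw [hfg, hw j g hg]⟩)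
    (fun i j f ⟨g, hg, hfg⟩ => by
      subst hfg
      rw [hw j g hg, hw i g hg, hw _ _ (contDiff_fderiv_apply hg _),
        hw _ _ (contDiff_fderiv_apply hg _)]
      exact funext fun z => fderiv_fderiv_comm hg _ _ _) 0 k ⟨g, hg, rfl⟩ (List.nodup_finRange d)
  rw [foldr_iterate_zero] at h
  simpa [wirtingerBarPow] using h

/-! ### Estimates for the symbol and its derivatives -/

/-- The holomorphic extension `(z, ζ) ↦ a(z, \bar ζ)` of a Wick symbol. -/
noncomputable def symbolExt (a : Cd d → Cd d → ℂ) (p : Cd d × Cd d) : ℂ := a p.1 (conjVec p.2)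

theorem eq_symbolExt (a : Cd d → Cd d → ℂ) (z w : Cd d) :
    a z w = symbolExt a (z, conjVec w) := by
  simp [symbolExt, conjVec_conjVec]

open scoped ContDiff in
theorem IsWickSymbol.contDiff {a : Cd d → Cd d → ℂ} (ha : IsWickSymbol a) :
    ContDiff ℂ ∞ (symbolExt a) :=
  contDiff_iff_contDiffAt.mpr fun p => (ha p (Set.mem_univ p)).contDiffAt

theorem fderiv_prodMk_left {h : Cd d × Cd d → ℂ} (hh : Differentiable ℂ h) (z ζ v : Cd d) :
    fderiv ℂ (fun z => h (z, ζ)) z v = fderiv ℂ h (z, ζ) (v, 0) := by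
  have := (hh (z, ζ)).hasFDerivAt.comp z (hasFDerivAt_prodMk_left (𝕜 := ℂ) z ζ)
  simp only [Function.comp_def] at this
  rw [this.fderiv]
  simp

theorem fderiv_prodMk_right {h : Cd d × Cd d → ℂ} (hh : Differentiable ℂ h) (z ζ v : Cd d) :
    fderiv ℂ (fun ζ => h (z, ζ)) ζ v = fderiv ℂ h (z, ζ) (0, v) := by
  have := (hh (z, ζ)).hasFDerivAt.comp ζ (hasFDerivAt_prodMk_right (𝕜 := ℂ) z ζ)
  simp only [Function.comp_def] at this
  rw [this.fderiv]
  simp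

section MixedDeriv

open scoped ContDiff

variable {a : Cd d → Cd d → ℂ}

theorem mixedDeriv_zero_zero (a : Cd d → Cd d → ℂ) (z w : Cd d) : mixedDeriv 0 0 a z w = a z w := by
  unfold mixedDeriv
  rw [wirtingerPow_zero, wirtingerBarPow_zero]

theorem IsWickSymbol.mixedDeriv_single_zero (ha : IsWickSymbol a) (j : Fin d) (z w : Cd d) :
    mixedDeriv (0 + Pi.single j 1) 0 a z w
      = fderiv ℂ (symbolExt a) (z, conjVec w) (stdVec j, 0) := by
  have hc : ContDiff ℂ ∞ fun z => symbolExt a (z, conjVec w) := ha.contDiff.comp (by fun_prop)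
  unfold mixedDeriv
  simp only [wirtingerBarPow_zero, eq_symbolExt a _ w]
  rw [wirtingerPow_add_single hc, wirtingerPow_zero, wirtinger_eq (hc.differentiable (by simp)),
    fderiv_prodMk_left (ha.contDiff.differentiable (by simp))]

theorem IsWickSymbol.mixedDeriv_single_add_single_zero (ha : IsWickSymbol a) (j k : Fin d)
    (z w : Cd d) :
    mixedDeriv (0 + Pi.single j 1 + Pi.single k 1) 0 a z w
      = fderiv ℂ (fun p => fderiv ℂ (symbolExt a) p (stdVec j, 0)) (z, conjVec w)
        (stdVec k, 0) := by
  have hc : ContDiff ℂ ∞ fun z => symbolExt a (z, conjVec w) := ha.contDiff.comp (by fun_prop)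
  have hc' := contDiff_fderiv_apply ha.contDiff (stdVec j, 0)
  have hc'' : ContDiff ℂ ∞ fun z => fderiv ℂ (symbolExt a) (z, conjVec w) (stdVec j, 0) :=
    hc'.comp (by fun_prop)
  have hw : wirtinger j (fun z => symbolExt a (z, conjVec w))
      = fun z => fderiv ℂ (symbolExt a) (z, conjVec w) (stdVec j, 0) := funext fun z => by
    rw [wirtinger_eq (hc.differentiable (by simp)),
      fderiv_prodMk_left (ha.contDiff.differentiable (by simp))]
  unfold mixedDeriv
  simp only [wirtingerBarPow_zero, eq_symbolExt a _ w]
  rw [wirtingerPow_add_single hc, wirtingerPow_add_single hc, wirtingerPow_zero, hw,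
    wirtinger_eq (hc''.differentiable (by simp)),
    fderiv_prodMk_left (hc'.differentiable (by simp))]

theorem IsWickSymbol.mixedDeriv_single_single (ha : IsWickSymbol a) (j : Fin d) (z w : Cd d) :
    mixedDeriv (0 + Pi.single j 1) (Pi.single j 1) a z w
      = fderiv ℂ (fun p => fderiv ℂ (symbolExt a) p (stdVec j, 0)) (z, conjVec w)
        (0, stdVec j) := by
  have hc' := contDiff_fderiv_apply ha.contDiff (0, stdVec j)
  have hb : ∀ z, wirtingerBarPow (Pi.single j 1) (fun w => a z w) w
      = fderiv ℂ (symbolExt a) (z, conjVec w) (0, stdVec j) := fun z => by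
    have hc : ContDiff ℂ ∞ fun ζ => symbolExt a (z, ζ) := ha.contDiff.comp (by fun_prop)
    simp only [eq_symbolExt a z]
    rw [wirtingerBarPow_single hc, wirtingerBar_comp_conj (hc.differentiable (by simp)),
      fderiv_prodMk_right (ha.contDiff.differentiable (by simp))]
  have hc : ContDiff ℂ ∞ fun z => fderiv ℂ (symbolExt a) (z, conjVec w) (0, stdVec j) :=
    hc'.comp (by fun_prop)
  unfold mixedDeriv
  simp only [hb]
  rw [wirtingerPow_add_single hc, wirtingerPow_zero, wirtinger_eq (hc.differentiable (by simp)),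
    fderiv_prodMk_left (hc'.differentiable (by simp)), fderiv_fderiv_comm ha.contDiff]

end MixedDeriv

theorem bracket_sqrt_two_smul_conjVec_le (z w : Cd d) :
    bracket (Real.sqrt 2 • conjVec z) ≤ bracket (z + w) * bracket (z - w) := by
  have h1 := bracket_pos (z + w)
  have h2 := bracket_pos (z - w)
  refine (sq_le_sq₀ (bracket_pos _).le (by positivity)).mp ?_
  rw [mul_pow, bracket_sq, bracket_sq, bracket_sq, norm_smul, norm_conjVec, mul_pow,
    Real.norm_of_nonneg (Real.sqrt_nonneg 2), Real.sq_sqrt zero_le_two]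
  have h3 : ‖(2 : ℂ) • z‖ ≤ ‖z + w‖ + ‖z - w‖ := by
    refine le_trans (le_of_eq ?_) (norm_add_le _ _)
    congr 1
    rw [two_smul]; abel
  rw [norm_smul, Complex.norm_ofNat] at h3
  have h4 : (2 * ‖z‖) ^ 2 ≤ (‖z + w‖ + ‖z - w‖) ^ 2 := by gcongr
  nlinarith [sq_nonneg (‖z + w‖ - ‖z - w‖), mul_nonneg (sq_nonneg ‖z + w‖) (sq_nonneg ‖z - w‖)]

theorem bracket_sqrt_two_smul_conjVec_le' (z : Cd d) :
    bracket (Real.sqrt 2 • conjVec z) ≤ 2 * bracket z := by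
  have h1 := bracket_pos z
  refine (sq_le_sq₀ (bracket_pos _).le (by positivity)).mp ?_
  rw [mul_pow, bracket_sq, bracket_sq, norm_smul, norm_conjVec, mul_pow,
    Real.norm_of_nonneg (Real.sqrt_nonneg 2), Real.sq_sqrt zero_le_two]
  nlinarith [sq_nonneg ‖z‖]

theorem rpow_le_pow_ceil {x s : ℝ} (hx : 1 ≤ x) : x ^ s ≤ x ^ ⌈s⌉₊ := by
  rw [← Real.rpow_natCast]
  exact Real.rpow_le_rpow_of_exponent_le hx (Nat.le_ceil s)

section Bounds

variable {ρ : ℝ} {a : Cd d → Cd d → ℂ}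

/-- Derivatives of every order grow at most like the weight. -/
theorem norm_mixedDeriv_le (hρ : 0 < ρ)
    (ha : a ∈ ShubinWickClass d ρ (fun z => bracket z ^ (2 * ρ))) (α β : Fin d → ℕ) (N : ℕ) :
    ∃ C : ℝ, 0 ≤ C ∧ ∀ z w, ‖mixedDeriv α β a z w‖ ≤ C * Real.exp (‖z - w‖ ^ 2 / 2)
      * bracket z ^ ⌈2 * ρ⌉₊ * (bracket (z - w) ^ N)⁻¹ := by
  obtain ⟨C, h⟩ := ha.2 α β N
  refine ⟨|C| * 2 ^ ⌈2 * ρ⌉₊, by positivity, fun z w => (h z w).trans ?_⟩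
  have hz := bracket_pos z
  have hu := bracket_pos (z - w)
  have h1 : bracket (Real.sqrt 2 • conjVec z) ^ (2 * ρ) ≤ 2 ^ ⌈2 * ρ⌉₊ * bracket z ^ ⌈2 * ρ⌉₊ := by
    rw [← mul_pow]
    exact (rpow_le_pow_ceil (one_le_bracket _)).trans
      (pow_le_pow_left₀ (bracket_pos _).le (bracket_sqrt_two_smul_conjVec_le' z) _)
  have h2 : bracket (z + w) ^ (-(ρ * (∑ j, ((α j + β j : ℕ) : ℝ)))) ≤ 1 :=
    Real.rpow_le_one_of_one_le_of_nonpos (one_le_bracket _)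
      (neg_nonpos.mpr (mul_nonneg hρ.le (Finset.sum_nonneg fun _ _ => Nat.cast_nonneg _)))
  have h3 := Real.rpow_nonneg (bracket_pos (z + w)).le (-(ρ * (∑ j, ((α j + β j : ℕ) : ℝ))))
  have h4 := Real.rpow_nonneg (bracket_pos (Real.sqrt 2 • conjVec z)).le (2 * ρ)
  rw [Real.rpow_neg hu.le, Real.rpow_natCast]
  calc _ ≤ |C| * Real.exp (‖z - w‖ ^ 2 / 2) * (2 ^ ⌈2 * ρ⌉₊ * bracket z ^ ⌈2 * ρ⌉₊) * 1
        * (bracket (z - w) ^ N)⁻¹ := by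
        gcongr
        exact le_abs_self C
    _ = _ := by ring

/-- Second-order derivatives gain two powers of `⟨z+w⟩^{-ρ}`, which cancels the weight. -/
theorem norm_mixedDeriv_le_of_order_two
    (ha : a ∈ ShubinWickClass d ρ (fun z => bracket z ^ (2 * ρ))) (hρ : 0 < ρ) {α β : Fin d → ℕ}
    (hαβ : ∑ j, ((α j + β j : ℕ) : ℝ) = 2) (N : ℕ) :
    ∃ C : ℝ, 0 ≤ C ∧ ∀ z w, ‖mixedDeriv α β a z w‖
      ≤ C * Real.exp (‖z - w‖ ^ 2 / 2) * (bracket (z - w) ^ N)⁻¹ := by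
  obtain ⟨C, h⟩ := ha.2 α β (N + ⌈2 * ρ⌉₊)
  refine ⟨|C|, abs_nonneg C, fun z w => (h z w).trans ?_⟩
  have hs := bracket_pos (z + w)
  have hu := bracket_pos (z - w)
  have h1 : bracket (Real.sqrt 2 • conjVec z) ^ (2 * ρ)
      ≤ bracket (z + w) ^ (2 * ρ) * bracket (z - w) ^ ⌈2 * ρ⌉₊ := by
    refine (Real.rpow_le_rpow (bracket_pos _).le (bracket_sqrt_two_smul_conjVec_le z w)
      (by positivity)).trans ?_
    rw [Real.mul_rpow hs.le hu.le]
    gcongr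
    exact rpow_le_pow_ceil (one_le_bracket _)
  have h4 := Real.rpow_nonneg (bracket_pos (Real.sqrt 2 • conjVec z)).le (2 * ρ)
  have h3 : 0 < bracket (z + w) ^ (2 * ρ) := Real.rpow_pos_of_pos hs _
  rw [hαβ, mul_comm ρ 2, Real.rpow_neg hu.le, Real.rpow_natCast, Real.rpow_neg hs.le]
  calc _ ≤ |C| * Real.exp (‖z - w‖ ^ 2 / 2)
        * (bracket (z + w) ^ (2 * ρ) * bracket (z - w) ^ ⌈2 * ρ⌉₊)
        * (bracket (z + w) ^ (2 * ρ))⁻¹ * (bracket (z - w) ^ (N + ⌈2 * ρ⌉₊))⁻¹ := by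
        gcongr
        exact le_abs_self C
    _ = _ := by rw [pow_add]; field_simp

theorem sum_single_one (k : Fin d) : ∑ j, ((Pi.single k 1 : Fin d → ℕ) j : ℝ) = 1 := by
  simp [Pi.single_apply]

end Bounds

/-- The bounds on a Wick symbol, and on its derivatives of order at most two, on which the sharp
Gårding inequality depends. They are stated in terms of the holomorphic extension of the symbol;
the second-order derivatives have no polynomial growth along the diagonal. -/
structure GardingSymbol (a : Cd d → Cd d → ℂ) : Prop where
  isWickSymbol : IsWickSymbol a
  bound : ∃ m : ℕ, ∀ N : ℕ, ∃ C : ℝ, 0 ≤ C ∧ ∀ z w, ‖a z w‖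
    ≤ C * Real.exp (‖z - w‖ ^ 2 / 2) * bracket z ^ m * (bracket (z - w) ^ N)⁻¹
  bound_deriv : ∃ m : ℕ, ∀ j, ∃ C : ℝ, 0 ≤ C ∧ ∀ w,
    ‖fderiv ℂ (symbolExt a) (w, conjVec w) (stdVec j, 0)‖ ≤ C * bracket w ^ m
  bound_deriv_deriv : ∀ j k (N : ℕ), ∃ C : ℝ, 0 ≤ C ∧ ∀ z w,
    ‖fderiv ℂ (fun p => fderiv ℂ (symbolExt a) p (stdVec j, 0)) (z, conjVec w) (stdVec k, 0)‖
      ≤ C * Real.exp (‖z - w‖ ^ 2 / 2) * (bracket (z - w) ^ N)⁻¹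
  bound_deriv_derivBar : ∀ j, ∃ C : ℝ, 0 ≤ C ∧ ∀ w,
    ‖fderiv ℂ (fun p => fderiv ℂ (symbolExt a) p (stdVec j, 0)) (w, conjVec w) (0, stdVec j)‖ ≤ C

theorem gardingSymbol_of_mem {ρ : ℝ} {a : Cd d → Cd d → ℂ} (hρ : 0 < ρ)
    (ha : a ∈ ShubinWickClass d ρ (fun z => bracket z ^ (2 * ρ))) : GardingSymbol a where
  isWickSymbol := ha.1
  bound := ⟨⌈2 * ρ⌉₊, fun N => by
    simpa only [mixedDeriv_zero_zero] using norm_mixedDeriv_le hρ ha 0 0 N⟩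
  bound_deriv := ⟨⌈2 * ρ⌉₊, fun j => by
    obtain ⟨C, hC, h⟩ := norm_mixedDeriv_le hρ ha (0 + Pi.single j 1) 0 0
    refine ⟨C, hC, fun w => ?_⟩
    rw [← ha.1.mixedDeriv_single_zero]
    simpa using h w w⟩
  bound_deriv_deriv j k N := by
    obtain ⟨C, hC, h⟩ := norm_mixedDeriv_le_of_order_two ha hρ
      (α := 0 + Pi.single j 1 + Pi.single k 1) (β := 0) (by
        simp only [zero_add, Pi.add_apply, Pi.zero_apply, add_zero, Nat.cast_add,
          Finset.sum_add_distrib, sum_single_one]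
        norm_num) N
    simp only [ha.1.mixedDeriv_single_add_single_zero] at h
    exact ⟨C, hC, h⟩
  bound_deriv_derivBar j := by
    obtain ⟨C, hC, h⟩ := norm_mixedDeriv_le_of_order_two ha hρ
      (α := 0 + Pi.single j 1) (β := Pi.single j 1) (by
        simp only [zero_add, Nat.cast_add, Finset.sum_add_distrib, sum_single_one]
        norm_num) 0
    refine ⟨C, hC, fun w => ?_⟩
    rw [← ha.1.mixedDeriv_single_single]
    simpa using h w w

theorem continuous_conjVec : Continuous (conjVec : Cd d → Cd d) := (conjCLM d).continuous

section Garding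

variable {a : Cd d → Cd d → ℂ}

theorem GardingSymbol.continuous (ha : GardingSymbol a) : Continuous fun p : Cd d × Cd d => a p.1 p.2 := by
  simp_rw [eq_symbolExt a]
  have h1 := ha.isWickSymbol.contDiff.continuous
  have h2 := continuous_conjVec (d := d)
  fun_prop

theorem GardingSymbol.temperateKernel (ha : GardingSymbol a) : TemperateKernel a := by
  refine ⟨ha.continuous, ?_⟩
  obtain ⟨m, h⟩ := ha.bound
  obtain ⟨C, hC, h⟩ := h 0
  refine ⟨m, C, hC, fun z w => (h z w).trans ?_⟩
  have hz := bracket_pos z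
  have hw : 1 ≤ bracket w ^ m := one_le_pow₀ (one_le_bracket w)
  rw [pow_zero, inv_one, mul_one]
  refine mul_le_mul_of_nonneg_left ?_ (by positivity)
  exact le_mul_of_one_le_right (by positivity) hw

/-- The integrand of the Wick operator decays rapidly in both variables. -/
theorem GardingSymbol.wickIntegrand_bound (ha : GardingSymbol a) {F : Cd d → ℂ}
    (hF : RapidFock F) (M N : ℕ) :
    ∃ C : ℝ, 0 ≤ C ∧ ∀ z w, ‖wickIntegrand a F z w‖
      ≤ C * Real.exp (‖z‖ ^ 2 / 2) * (bracket z ^ M)⁻¹ * (bracket w ^ N)⁻¹ := by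
  obtain ⟨m, h⟩ := ha.bound
  obtain ⟨A, hA, h⟩ := h (M + m)
  obtain ⟨B, hB, h'⟩ := hF.decay (N + (M + m))
  refine ⟨A * B * 2 ^ (M + m), by positivity, fun z w => ?_⟩
  have hz := bracket_pos z
  have hw := bracket_pos w
  have hu := bracket_pos (z - w)
  have := norm_wickIntegrand_le a (F := F) (A := A)
    (B := bracket z ^ m * (bracket (z - w) ^ (M + m))⁻¹)
    (M := B * (bracket w ^ (N + (M + m)))⁻¹) (by rw [← mul_assoc]; exact h z w)
    (by rw [mul_one, mul_right_comm]; exact h' w)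
  refine this.trans ?_
  -- Peetre's inequality trades the decay in `z - w` and `w` for decay in `z`.
  have hP := bracket_pow_le (M + m) z w
  have hP' : (bracket (z - w) ^ (M + m))⁻¹ * (bracket w ^ (M + m))⁻¹
      ≤ 2 ^ (M + m) * (bracket z ^ (M + m))⁻¹ := by
    rw [← mul_inv, ← div_eq_mul_inv, inv_eq_one_div, div_le_div_iff₀ (by positivity) (by positivity)]
    linarith
  calc _ = A * B * Real.exp (‖z‖ ^ 2 / 2) * bracket z ^ m * (bracket w ^ N)⁻¹
        * ((bracket (z - w) ^ (M + m))⁻¹ * (bracket w ^ (M + m))⁻¹) := by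
        rw [pow_add _ N, mul_inv]; ring
    _ ≤ A * B * Real.exp (‖z‖ ^ 2 / 2) * bracket z ^ m * (bracket w ^ N)⁻¹
        * (2 ^ (M + m) * (bracket z ^ (M + m))⁻¹) := by gcongr
    _ = _ := by rw [pow_add (bracket z) M m, mul_inv]; field_simp

/-- Wick operators preserve the space of rapidly decaying entire functions. -/
theorem GardingSymbol.rapidFock_wickOp (ha : GardingSymbol a) {F : Cd d → ℂ}
    (hF : RapidFock F) :
    RapidFock (wickOp a F) := by
  have hint := integrable_inv_bracket_decayExp (d := d)
  refine ⟨Differentiable.const_mul (differentiable_integral_of_dominated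
    (continuous_wickIntegrand ha.continuous hF.differentiable.continuous) (fun w => ?_)
    fun z₀ => ?_) _, fun N => ?_⟩
  · have h : Differentiable ℂ fun z => symbolExt a (z, conjVec w) :=
      (ha.isWickSymbol.contDiff.differentiable (by simp)).comp (by fun_prop)
    simp only [wickIntegrand, eq_symbolExt a, scal]
    fun_prop
  · obtain ⟨C, hC, h⟩ := ha.wickIntegrand_bound hF 0 (decayExp d)
    refine ⟨_, hint.const_mul (C * Real.exp ((‖z₀‖ + 2) ^ 2 / 2)), fun z hz w =>
      (h z w).trans ?_⟩
    have hw := bracket_pos w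
    have hz' : ‖z‖ ≤ ‖z₀‖ + 2 := by
      calc ‖z‖ = ‖z₀ + (z - z₀)‖ := by congr 1; abel
        _ ≤ ‖z₀‖ + ‖z - z₀‖ := norm_add_le _ _
        _ ≤ ‖z₀‖ + 2 := by gcongr
    rw [pow_zero, inv_one, mul_one]
    gcongr
  · obtain ⟨C, hC, h⟩ := ha.wickIntegrand_bound hF N (decayExp d)
    refine ⟨Real.pi ^ (-(d : ℝ)) * (C * ∫ w : Cd d, (bracket w ^ decayExp d)⁻¹),
      by have : 0 ≤ ∫ w : Cd d, (bracket w ^ decayExp d)⁻¹ := integral_nonneg fun w => by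
          have := bracket_pos w
          positivity
         positivity, fun z => ?_⟩
    unfold wickOp
    rw [norm_mul, Complex.norm_real, Real.norm_of_nonneg (by positivity), mul_assoc, mul_assoc]
    gcongr
    refine (norm_integral_le_of_norm_le (hint.const_mul _)
      (Filter.Eventually.of_forall (h z))).trans (le_of_eq ?_)
    rw [integral_const_mul]
    ring

end Garding

/-! ### The reproducing formula and Toeplitz forms -/

theorem integral_fockDensity : ∫ z : Cd d, fockDensity z = 1 := by
  have h := GaussianFourier.integral_rexp_neg_mul_sq_norm (V := Cd d) one_pos
  simp only [fockDensity]
  rw [integral_const_mul]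
  simp only [neg_mul, one_mul, div_one] at h
  rw [h, finrank_real_Cd, ← Real.rpow_add Real.pi_pos]
  push_cast
  rw [mul_div_cancel_left₀ _ two_ne_zero, neg_add_cancel, Real.rpow_zero]

/-- Multiplication by a complex number of modulus one, as a real-linear isometry. -/
noncomputable def unitSmul {c : ℂ} (hc : ‖c‖ = 1) : Cd d ≃ₗᵢ[ℝ] Cd d where
  toLinearEquiv := (LinearEquiv.smulOfNeZero ℂ (Cd d) c
    (norm_ne_zero_iff.mp (by rw [hc]; exact one_ne_zero))).restrictScalars ℝ
  norm_map' z := by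
    change ‖c • z‖ = ‖z‖
    rw [norm_smul, hc, one_mul]

theorem integral_comp_unit_smul {E : Type*} [NormedAddCommGroup E] [NormedSpace ℝ E] {c : ℂ}
    (hc : ‖c‖ = 1) (f : Cd d → E) : ∫ z, f (c • z) = ∫ z, f z :=
  (unitSmul hc).measurePreserving.integral_comp
    (unitSmul hc).toHomeomorph.measurableEmbedding f

theorem integrable_comp_unit_smul {E : Type*} [NormedAddCommGroup E] {c : ℂ}
    (hc : ‖c‖ = 1) {f : Cd d → E} (hf : Integrable f) : Integrable fun z => f (c • z) :=
  ((unitSmul hc).measurePreserving.integrable_comp_emb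
    (unitSmul hc).toHomeomorph.measurableEmbedding).mpr hf

/-- The mean value property for the Gaussian measure: the measure is invariant under
`z ↦ e^{iθ} z`, and averaging over `θ` reduces the claim to the mean value property on circles. -/
theorem integral_fockDensity_mul {G : Cd d → ℂ} (hG : Differentiable ℂ G)
    (hint : Integrable fun z => (fockDensity z : ℂ) * G z) :
    ∫ z, (fockDensity z : ℂ) * G z = G 0 := by
  set ν : Measure ℝ := volume.restrict (Set.Ioc 0 (2 * Real.pi)) with hν
  have hpi : (0 : ℝ) ≤ 2 * Real.pi := Real.two_pi_pos.le
  have hc : ∀ θ : ℝ, ‖circleMap 0 1 θ‖ = 1 := fun θ => by simp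
  have hfd : ∀ (θ : ℝ) (z : Cd d), fockDensity (circleMap 0 1 θ • z) = fockDensity z :=
    fun θ z => by simp only [fockDensity, norm_smul, hc, one_mul]
  set Φ : ℝ → Cd d → ℂ := fun θ z => (fockDensity z : ℂ) * G (circleMap 0 1 θ • z) with hΦ
  have hΦint : ∀ θ, Integrable (Φ θ) := fun θ => by
    have := integrable_comp_unit_smul (hc θ) hint
    simpa only [hfd] using this
  have hΦI : ∀ θ, ∫ z, Φ θ z = ∫ z, (fockDensity z : ℂ) * G z := fun θ => by
    have := integral_comp_unit_smul (hc θ) (fun z : Cd d => (fockDensity z : ℂ) * G z)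
    simpa only [hfd] using this
  have hΦN : ∀ θ, ∫ z, ‖Φ θ z‖ = ∫ z, ‖(fockDensity z : ℂ) * G z‖ := fun θ => by
    have := integral_comp_unit_smul (hc θ) (fun z : Cd d => ‖(fockDensity z : ℂ) * G z‖)
    simpa only [hfd] using this
  have hcont : Continuous (Function.uncurry Φ) := by
    have h1 := hG.continuous
    have h2 := continuous_fockDensity (d := d)
    simp only [hΦ, Function.uncurry_def]
    fun_prop
  have hprod : Integrable (Function.uncurry Φ) (ν.prod volume) := by
    refine (integrable_prod_iff hcont.aestronglyMeasurable).mpr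
      ⟨Filter.Eventually.of_forall hΦint, ?_⟩
    simp only [Function.uncurry_apply_pair, hΦN]
    exact integrable_const _
  have hswap := integral_integral_swap hprod
  have hmean : ∀ z, ∫ θ, Φ θ z ∂ν = (2 * Real.pi : ℂ) * G 0 * fockDensity z := fun z => by
    have hd : DiffContOnCl ℂ (fun t : ℂ => G (t • z)) (Metric.ball 0 |1|) :=
      Differentiable.diffContOnCl (by fun_prop)
    have h := hd.circleAverage
    rw [Real.circleAverage_def, intervalIntegral.integral_of_le hpi, zero_smul] at h
    simp only [hΦ]
    rw [integral_const_mul, ← h, Complex.real_smul]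
    push_cast
    have : (Real.pi : ℂ) ≠ 0 := Complex.ofReal_ne_zero.mpr Real.pi_ne_zero
    field_simp
    rw [hν]
  simp only [hΦI, hmean] at hswap
  rw [integral_const, integral_const_mul, integral_complex_ofReal, integral_fockDensity, hν,
    measureReal_restrict_apply_univ, Real.volume_real_Ioc_of_le hpi, sub_zero,
    Complex.real_smul, Complex.ofReal_one, mul_one] at hswap
  push_cast at hswap
  refine mul_left_cancel₀ ?_ hswap
  exact mul_ne_zero two_ne_zero (Complex.ofReal_ne_zero.mpr Real.pi_ne_zero)

theorem continuous_scal_left (w : Cd d) : Continuous fun z : Cd d => scal z w :=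
  continuous_scal.comp (Continuous.prodMk_left w)

theorem conj_scal (z w : Cd d) : (starRingEnd ℂ) (scal z w) = scal w z := by
  rw [scal_eq_inner, scal_eq_inner, inner_conj_symm]

theorem scal_add_left (z z' w : Cd d) : scal (z + z') w = scal z w + scal z' w := by
  simp only [scal_eq_inner, inner_add_right]

theorem scal_sub_left (z z' w : Cd d) : scal (z - z') w = scal z w - scal z' w := by
  simp only [scal_eq_inner, inner_sub_right]

theorem scal_self (w : Cd d) : scal w w = ((‖w‖ ^ 2 : ℝ) : ℂ) := by
  rw [scal_eq_inner, inner_self_eq_norm_sq_to_K]; norm_cast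

theorem RapidFock.integrable_conj_mul_exp_scal {F : Cd d → ℂ} (hF : RapidFock F) (w : Cd d) :
    Integrable fun z => (fockDensity z : ℂ) * ((starRingEnd ℂ) (F z) * Complex.exp (scal z w)) := by
  obtain ⟨C, hC, h⟩ := hF.decay (decayExp d)
  refine ((integrable_inv_bracket_decayExp (d := d)).const_mul
    (Real.pi ^ (-(d : ℝ)) * C * Real.exp (‖w‖ ^ 2 / 2))).mono' ?_
    (Filter.Eventually.of_forall fun z => ?_)
  · have h1 := Complex.continuous_conj.comp hF.differentiable.continuous
    have h2 := Complex.continuous_exp.comp (continuous_scal_left w)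
    have h3 := Complex.continuous_ofReal.comp (continuous_fockDensity (d := d))
    exact (h3.mul (h1.mul h2)).aestronglyMeasurable
  · have hz := bracket_pos z
    have hre : (scal z w).re ≤ ‖z‖ ^ 2 / 2 + ‖w‖ ^ 2 / 2 := by
      have h1 : (scal z w).re ≤ ‖w‖ * ‖z‖ := by
        rw [scal_eq_inner]
        exact (Complex.re_le_norm _).trans (norm_inner_le_norm w z)
      nlinarith [sq_nonneg (‖w‖ - ‖z‖)]
    have he : Real.exp (-‖z‖ ^ 2) * (Real.exp (‖z‖ ^ 2 / 2) * Real.exp (‖z‖ ^ 2 / 2)) = 1 := by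
      rw [← Real.exp_add, ← Real.exp_add, ← Real.exp_zero]; congr 1; ring
    rw [norm_mul, norm_mul, RCLike.norm_conj, Complex.norm_real, Complex.norm_exp,
      Real.norm_of_nonneg (fockDensity_nonneg z)]
    have h0 := fockDensity_nonneg z
    calc _ ≤ fockDensity z * ((C * Real.exp (‖z‖ ^ 2 / 2) * (bracket z ^ decayExp d)⁻¹)
          * Real.exp (‖z‖ ^ 2 / 2 + ‖w‖ ^ 2 / 2)) := by
          gcongr
          exact h z
      _ = Real.pi ^ (-(d : ℝ)) * C * Real.exp (‖w‖ ^ 2 / 2) * (bracket z ^ decayExp d)⁻¹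
          * (Real.exp (-‖z‖ ^ 2) * (Real.exp (‖z‖ ^ 2 / 2) * Real.exp (‖z‖ ^ 2 / 2))) := by
          rw [Real.exp_add, fockDensity]; ring
      _ = _ := by rw [he, mul_one]

/-- The reproducing formula of the Fock space. A translation by `w` turns it into the mean value
property of the entire function `u ↦ F(w+u) e^{-(u,w)}`. -/
theorem RapidFock.reproducing {F : Cd d → ℂ} (hF : RapidFock F) (w : Cd d) :
    ∫ z, (fockDensity z : ℂ) * ((starRingEnd ℂ) (F z) * Complex.exp (scal z w))
      = (starRingEnd ℂ) (F w) := by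
  set G : Cd d → ℂ := fun u => F (w + u) * Complex.exp (-scal u w) with hG
  have hGd : Differentiable ℂ G := by
    have := hF.differentiable
    simp only [hG, scal]
    fun_prop
  have hkey : ∀ u, (fockDensity (w + u) : ℂ)
      * ((starRingEnd ℂ) (F (w + u)) * Complex.exp (scal (w + u) w))
      = (starRingEnd ℂ) ((fockDensity u : ℂ) * G u) := by
    intro u
    have hn : -‖w + u‖ ^ 2 = -‖u‖ ^ 2 + (-‖w‖ ^ 2 - 2 * (scal u w).re) := by
      have := norm_add_sq (𝕜 := ℂ) w u
      rw [← scal_eq_inner] at this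
      simp only [RCLike.re_to_complex] at this
      linarith
    have hfd : (fockDensity (w + u) : ℂ) = (fockDensity u : ℂ)
        * Complex.exp (-((‖w‖ ^ 2 : ℝ) : ℂ) - (scal u w + scal w u)) := by
      have h2 : scal u w + scal w u = ((2 * (scal u w).re : ℝ) : ℂ) := by
        rw [← conj_scal u w, Complex.add_conj]
      rw [h2, ← Complex.ofReal_neg, ← Complex.ofReal_sub, ← Complex.ofReal_exp,
        ← Complex.ofReal_mul]
      congr 1
      rw [fockDensity, hn, Real.exp_add, fockDensity, mul_assoc]
    simp only [hG, map_mul, Complex.conj_ofReal, ← Complex.exp_conj, map_neg, conj_scal]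
    rw [hfd, scal_add_left, scal_self]
    have h3 : Complex.exp (-((‖w‖ ^ 2 : ℝ) : ℂ) - (scal u w + scal w u))
        * Complex.exp (((‖w‖ ^ 2 : ℝ) : ℂ) + scal u w) = Complex.exp (-scal w u) := by
      rw [← Complex.exp_add]; congr 1; ring
    linear_combination (fockDensity u : ℂ) * (starRingEnd ℂ) (F (w + u)) * h3
  have hint := (hF.integrable_conj_mul_exp_scal w).comp_add_left w
  simp only [hkey] at hint
  have hint' : Integrable fun u => (fockDensity u : ℂ) * G u := by
    refine hint.mono ?_ (Filter.Eventually.of_forall fun u => by rw [RCLike.norm_conj])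
    exact ((Complex.continuous_ofReal.comp continuous_fockDensity).mul
      hGd.continuous).aestronglyMeasurable
  rw [← integral_add_left_eq_self _ w]
  simp only [hkey]
  rw [integral_conj, integral_fockDensity_mul hGd hint']
  simp [hG, scal]

/-- The form of a Toeplitz operator is integration of its symbol against `|F|²`. -/
theorem TemperateKernel.toeplitz {b : Cd d → ℂ} (hb : TemperateKernel fun _ w => b w)
    {F : Cd d → ℂ} (hF : RapidFock F) :
    Integrable (fun w => b w * ((fockDensity w * ‖F w‖ ^ 2 : ℝ) : ℂ)) ∧
    fockInner (wickOp (fun _ w => b w) F) F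
      = ∫ w, b w * ((fockDensity w * ‖F w‖ ^ 2 : ℝ) : ℂ) := by
  have hint := hb.integrable_pairingIntegrand hF
  have hinner : ∀ w, ∫ z, pairingIntegrand (fun _ w => b w) F z w
      = b w * ((fockDensity w * ‖F w‖ ^ 2 : ℝ) : ℂ) := by
    intro w
    have h1 : ∀ z, pairingIntegrand (fun _ w => b w) F z w = (fockDensity w * b w * F w : ℂ)
        * ((fockDensity z : ℂ) * ((starRingEnd ℂ) (F z) * Complex.exp (scal z w))) := by
      intro z
      have h2 : Complex.exp (scal (z - w) w)
          = Complex.exp (scal z w) * ((Real.exp (-‖w‖ ^ 2) : ℝ) : ℂ) := by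
        rw [scal_sub_left, scal_self, sub_eq_add_neg, Complex.exp_add, ← Complex.ofReal_neg,
          Complex.ofReal_exp]
      simp only [pairingIntegrand, wickIntegrand, h2, fockDensity]
      push_cast
      ring
    simp only [h1]
    rw [integral_const_mul, hF.reproducing w]
    have h3 : F w * (starRingEnd ℂ) (F w) = ((‖F w‖ ^ 2 : ℝ) : ℂ) := by
      rw [Complex.mul_conj, Complex.normSq_eq_norm_sq]
    push_cast at h3 ⊢
    linear_combination (fockDensity w * b w : ℂ) * h3
  constructor
  · have := hint.integral_prod_right
    simpa only [Function.uncurry_apply_pair, hinner] using this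
  · rw [fockInner_wickOp, integral_integral_swap hint]
    simp only [hinner]

/-- Toeplitz operators with bounded symbols are bounded. -/
theorem TemperateKernel.norm_toeplitz_le {b : Cd d → ℂ} (hb : TemperateKernel fun _ w => b w)
    {B : ℝ} (hB : ∀ w, ‖b w‖ ≤ B) {F : Cd d → ℂ} (hF : RapidFock F) :
    ‖fockInner (wickOp (fun _ w => b w) F) F‖ ≤ B * fockNorm F ^ 2 := by
  rw [(hb.toeplitz hF).2, fockNorm_sq, ← integral_const_mul]
  refine norm_integral_le_of_norm_le (hF.integrable_sq.const_mul B)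
    (Filter.Eventually.of_forall fun w => ?_)
  have h0 : 0 ≤ fockDensity w * ‖F w‖ ^ 2 := mul_nonneg (fockDensity_nonneg w) (sq_nonneg _)
  rw [norm_mul, Complex.norm_real, Real.norm_of_nonneg h0]
  gcongr
  exact hB w

/-- The form of a Toeplitz operator with real symbol is real, and the symbol's lower bound is a
lower bound for the form. -/
theorem TemperateKernel.toeplitz_real {b : Cd d → ℂ} (hb : TemperateKernel fun _ w => b w)
    (him : ∀ w, (b w).im = 0) {c : ℝ} (hre : ∀ w, c ≤ (b w).re) {F : Cd d → ℂ}
    (hF : RapidFock F) :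
    c * fockNorm F ^ 2 ≤ (fockInner (wickOp (fun _ w => b w) F) F).re ∧
      (fockInner (wickOp (fun _ w => b w) F) F).im = 0 := by
  obtain ⟨hint, heq⟩ := hb.toeplitz hF
  have hb' : ∀ w, b w * ((fockDensity w * ‖F w‖ ^ 2 : ℝ) : ℂ)
      = (((b w).re * (fockDensity w * ‖F w‖ ^ 2) : ℝ) : ℂ) := fun w => by
    have hr : b w = ((b w).re : ℂ) := Complex.ext rfl (by rw [him w, Complex.ofReal_im])
    rw [Complex.ofReal_mul (b w).re, ← hr]
  simp only [hb'] at hint heq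
  rw [integral_complex_ofReal] at heq
  rw [heq]
  refine ⟨?_, Complex.ofReal_im _⟩
  rw [Complex.ofReal_re, fockNorm_sq, ← integral_const_mul]
  refine integral_mono (hF.integrable_sq.const_mul c) ?_ fun w => ?_
  · exact hint.re
  · have h0 : 0 ≤ fockDensity w * ‖F w‖ ^ 2 := mul_nonneg (fockDensity_nonneg w) (sq_nonneg _)
    exact mul_le_mul_of_nonneg_right (hre w) h0

/-! ### Integration by parts in the antiholomorphic variable -/

theorem integral_hasFDerivAt_apply_eq_zero {f : Cd d → ℂ} {f' : Cd d → Cd d →L[ℝ] ℂ}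
    (hf : ∀ w, HasFDerivAt f (f' w) w) (v : Cd d) (hint : Integrable f)
    (hint' : Integrable fun w => f' w v) : ∫ w, f' w v = 0 := by
  have h := integral_bilinear_hasLineDerivAt_right_eq_neg_left_of_integrable
    (μ := (volume : Measure (Cd d))) (v := v) (f := fun _ => (1 : ℂ)) (f' := fun _ => 0)
    (g := f) (g' := fun w => f' w v) (B := ContinuousLinearMap.mul ℝ ℂ)
    (by simp) (by simpa using hint') (by simpa using hint)
    (fun w _ => (hasFDerivAt_const (1 : ℂ) w).hasLineDerivAt v)
    (fun w _ => (hf w).hasLineDerivAt v)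
  simpa using h

/-- The integral of `∂_{\bar w_j} (H(w, \bar w))` vanishes. -/
theorem integral_fderiv_comp_conj_eq_zero {H : Cd d × Cd d → ℂ} (hH : Differentiable ℂ H)
    (j : Fin d) (h₀ : Integrable fun w => H (w, conjVec w))
    (h₁ : Integrable fun w => fderiv ℂ H (w, conjVec w) (stdVec j, 0))
    (h₂ : Integrable fun w => fderiv ℂ H (w, conjVec w) (0, stdVec j)) :
    ∫ w, fderiv ℂ H (w, conjVec w) (0, stdVec j) = 0 := by
  have hd := hasFDerivAt_comp_conj hH
  have hv : ∀ (c : ℂ) (w : Cd d),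
      (((fderiv ℂ H (w, conjVec w)).comp (ContinuousLinearMap.inl ℂ _ _)).restrictScalars ℝ
        + (((fderiv ℂ H (w, conjVec w)).comp
          (ContinuousLinearMap.inr ℂ _ _)).restrictScalars ℝ).comp (conjCLM d)) (c • stdVec j)
      = c * fderiv ℂ H (w, conjVec w) (stdVec j, 0)
        + (starRingEnd ℂ) c * fderiv ℂ H (w, conjVec w) (0, stdVec j) := fun c w => by
    simp only [add_apply, ContinuousLinearMap.coe_restrictScalars',
      ContinuousLinearMap.comp_apply, conjCLM_apply, conjVec_smul, conjVec_stdVec, map_smul,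
      smul_eq_mul, ContinuousLinearMap.inl_apply, ContinuousLinearMap.inr_apply]
  have key : ∀ c : ℂ, c * (∫ w, fderiv ℂ H (w, conjVec w) (stdVec j, 0))
      + (starRingEnd ℂ) c * ∫ w, fderiv ℂ H (w, conjVec w) (0, stdVec j) = 0 := fun c => by
    have h := integral_hasFDerivAt_apply_eq_zero hd (c • stdVec j) h₀
      (by simp only [hv]; exact (h₁.const_mul _).add (h₂.const_mul _))
    simp only [hv] at h
    rwa [integral_add (h₁.const_mul _) (h₂.const_mul _), integral_const_mul,
      integral_const_mul] at h
  -- The real directions `e_j` and `i e_j` separate the two Wirtinger derivatives.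
  have k1 := key 1
  have kI := key Complex.I
  rw [map_one] at k1
  rw [Complex.conj_I] at kI
  linear_combination (1 / 2 : ℂ) * k1 + (Complex.I / 2) * kI
    + ((∫ w, fderiv ℂ H (w, conjVec w) (0, stdVec j)) / 2
      - (∫ w, fderiv ℂ H (w, conjVec w) (stdVec j, 0)) / 2) * Complex.I_mul_I

theorem fderiv_apply_of_affine {E : Type*} [NormedAddCommGroup E] [NormedSpace ℂ E] {f : E → ℂ}
    {p v : E} {c : ℂ} (hf : DifferentiableAt ℂ f p) (h : ∀ t : ℂ, f (p + t • v) = f p + t * c) :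
    fderiv ℂ f p v = c := by
  rw [← hf.lineDeriv_eq_fderiv, lineDeriv]
  simp only [h]
  simp

/-- The phase `(z - w) · ζ`, holomorphic in `(w, ζ)`; at `ζ = \bar w` it is `(z - w, w)`. -/
noncomputable def phase (z : Cd d) (p : Cd d × Cd d) : ℂ := ∑ i, (z i - p.1 i) * p.2 i

theorem phase_conj (z w : Cd d) : phase z (w, conjVec w) = scal (z - w) w := rfl

theorem differentiable_phase (z : Cd d) : Differentiable ℂ (phase z) := by
  have h1 : ∀ i : Fin d, Differentiable ℂ fun p : Cd d × Cd d => p.1 i := fun i =>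
    (EuclideanSpace.proj (𝕜 := ℂ) i).differentiable.comp differentiable_fst
  have h2 : ∀ i : Fin d, Differentiable ℂ fun p : Cd d × Cd d => p.2 i := fun i =>
    (EuclideanSpace.proj (𝕜 := ℂ) i).differentiable.comp differentiable_snd
  unfold phase
  fun_prop

theorem fderiv_phase_fst (z : Cd d) (p : Cd d × Cd d) (j : Fin d) :
    fderiv ℂ (phase z) p (stdVec j, 0) = -p.2 j := by
  refine fderiv_apply_of_affine (differentiable_phase z p) fun t => ?_
  have : ∀ i, (z i - (p + t • ((stdVec j, 0) : Cd d × Cd d)).1 i)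
      * (p + t • ((stdVec j, 0) : Cd d × Cd d)).2 i
      = (z i - p.1 i) * p.2 i + if i = j then t * -p.2 i else 0 := fun i => by
    by_cases h : i = j <;> simp [h]
    ring
  simp only [phase, this, Finset.sum_add_distrib, Finset.sum_ite_eq', Finset.mem_univ, if_true]

theorem fderiv_phase_snd (z : Cd d) (p : Cd d × Cd d) (j : Fin d) :
    fderiv ℂ (phase z) p (0, stdVec j) = z j - p.1 j := by
  refine fderiv_apply_of_affine (differentiable_phase z p) fun t => ?_
  have : ∀ i, (z i - (p + t • ((0, stdVec j) : Cd d × Cd d)).1 i)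
      * (p + t • ((0, stdVec j) : Cd d × Cd d)).2 i
      = (z i - p.1 i) * p.2 i + if i = j then t * (z i - p.1 i) else 0 := fun i => by
    by_cases h : i = j <;> simp [h]
    ring
  simp only [phase, this, Finset.sum_add_distrib, Finset.sum_ite_eq', Finset.mem_univ, if_true]

/-- Under the Wick quantization a factor `z_j - w_j` acts as `-∂_{\bar w_j}` on the rest of a
symbol that depends on `w` only. -/
theorem integral_wickIntegrand_coord_mul {h : Cd d × Cd d → ℂ} (hh : Differentiable ℂ h)
    {F : Cd d → ℂ} (hF : RapidFock F) (j : Fin d)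
    (k₀ : TemperateKernel fun _ w : Cd d => h (w, conjVec w))
    (k₁ : TemperateKernel fun _ w : Cd d => fderiv ℂ h (w, conjVec w) (stdVec j, 0))
    (k₂ : TemperateKernel fun _ w : Cd d => fderiv ℂ h (w, conjVec w) (0, stdVec j))
    (k₃ : TemperateKernel fun _ w : Cd d => h (w, conjVec w) * conjVec w j) (z : Cd d) :
    ∫ w, wickIntegrand (fun z w => (z - w) j * h (w, conjVec w)) F z w
      = -∫ w, wickIntegrand (fun _ w => fderiv ℂ h (w, conjVec w) (0, stdVec j)) F z w := by
  set H : Cd d × Cd d → ℂ := fun p => h p * F p.1 * Complex.exp (phase z p) with hH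
  have hFd := hF.differentiable
  have hHd : ∀ p, HasFDerivAt H _ p := fun p =>
    (((hh p).hasFDerivAt.mul ((hFd p.1).hasFDerivAt.comp p hasFDerivAt_fst)).mul
      (differentiable_phase z p).hasFDerivAt.cexp)
  have h1 : ∀ w, fderiv ℂ H (w, conjVec w) (stdVec j, 0)
      = wickIntegrand (fun _ w => fderiv ℂ h (w, conjVec w) (stdVec j, 0)) F z w
        + wickIntegrand (fun _ w => h (w, conjVec w)) (fun w => fderiv ℂ F w (stdVec j)) z w
        - wickIntegrand (fun _ w => h (w, conjVec w) * conjVec w j) F z w := fun w => by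
    rw [(hHd _).fderiv]
    simp only [add_apply, smul_apply, smul_eq_mul, fderiv_phase_fst, Pi.mul_apply, Function.comp_apply,
      ContinuousLinearMap.comp_apply, ContinuousLinearMap.coe_fst', wickIntegrand, phase_conj]
    ring
  have h2 : ∀ w, fderiv ℂ H (w, conjVec w) (0, stdVec j)
      = wickIntegrand (fun z w => (z - w) j * h (w, conjVec w)) F z w
        + wickIntegrand (fun _ w => fderiv ℂ h (w, conjVec w) (0, stdVec j)) F z w := fun w => by
    rw [(hHd _).fderiv]
    simp only [add_apply, smul_apply, smul_eq_mul, fderiv_phase_snd, Pi.mul_apply, Function.comp_apply,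
      ContinuousLinearMap.comp_apply, ContinuousLinearMap.coe_fst', wickIntegrand, phase_conj,
      map_zero, PiLp.sub_apply]
    ring
  have i0 := k₀.integrable_wickIntegrand hF z
  have i1 := ((k₁.integrable_wickIntegrand hF z).add
    (k₀.integrable_wickIntegrand_of_decay (measurable_fderiv_apply_const ℂ F (stdVec j))
      (hF.rapidDecay_fderiv (norm_stdVec j).le) z)).sub (k₃.integrable_wickIntegrand hF z)
  have i2 := (k₀.coord_mul j).integrable_wickIntegrand hF z
  have i3 := k₂.integrable_wickIntegrand hF z
  have := integral_fderiv_comp_conj_eq_zero (fun p => (hHd p).differentiableAt) j i0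
    (by simp only [h1]; exact i1) (by simp only [h2]; exact i2.add i3)
  simp only [h2] at this
  rw [integral_add i2 i3] at this
  exact eq_neg_of_add_eq_zero_left this

/-! ### Boundedness of kernels concentrated near the diagonal -/

/-- Schur's test: a kernel bounded by `e^{|z-w|²/2} ⟨z-w⟩^{-N}` with `N > 2d` has a bounded
form. -/
theorem TemperateKernel.norm_fockInner_le {k : Cd d → Cd d → ℂ} (hk : TemperateKernel k) {C : ℝ}
    (h : ∀ z w, ‖k z w‖
      ≤ C * Real.exp (‖z - w‖ ^ 2 / 2) * (bracket (z - w) ^ decayExp d)⁻¹)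
    {F : Cd d → ℂ} (hF : RapidFock F) :
    ‖fockInner (wickOp k F) F‖
      ≤ C * Real.pi ^ (-(d : ℝ)) * (∫ u : Cd d, (bracket u ^ decayExp d)⁻¹) * fockNorm F ^ 2 := by
  set κ : Cd d → ℝ := fun u => (bracket u ^ decayExp d)⁻¹ with hκ
  set g : Cd d → ℝ := fun z => fockDensity z * ‖F z‖ ^ 2 with hg
  have hκint : Integrable κ := integrable_inv_bracket_decayExp
  have hgint : Integrable g := hF.integrable_sq
  have hp : Integrable (fun p : Cd d × Cd d => κ p.1 * g p.2) (volume.prod volume) :=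
    hκint.mul_prod hgint
  have hmp : MeasurePreserving (fun p : Cd d × Cd d => (p.1 - p.2, p.2))
      (volume.prod volume) (volume.prod volume) := measurePreserving_sub_prod volume volume
  have hq : Integrable (fun p : Cd d × Cd d => κ (p.1 - p.2) * g p.2) (volume.prod volume) :=
    hmp.integrable_comp_of_integrable hp
  have hqI : ∫ p : Cd d × Cd d, κ (p.1 - p.2) * g p.2 ∂(volume.prod volume)
      = (∫ u, κ u) * ∫ z, g z := by
    have h1 := integral_map hmp.measurable.aemeasurable (by
      rw [hmp.map_eq]; exact hp.aestronglyMeasurable)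
    rw [hmp.map_eq, integral_prod_mul] at h1
    exact h1.symm
  have hsymm : ∀ p : Cd d × Cd d, κ (p.1 - p.2) * g p.1
      = (fun p : Cd d × Cd d => κ (p.1 - p.2) * g p.2) p.swap := fun p => by
    simp only [hκ, Prod.fst_swap, Prod.snd_swap]
    rw [← neg_sub, bracket_neg]
  have hr : Integrable (fun p : Cd d × Cd d => κ (p.1 - p.2) * g p.1) (volume.prod volume) := by
    simp only [hsymm]
    exact hq.swap
  have hrI : ∫ p : Cd d × Cd d, κ (p.1 - p.2) * g p.1 ∂(volume.prod volume)
      = (∫ u, κ u) * ∫ z, g z := by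
    simp only [hsymm]
    rw [← hqI]
    exact integral_prod_swap fun p : Cd d × Cd d => κ (p.1 - p.2) * g p.2
  have hbound : ∀ p : Cd d × Cd d, ‖pairingIntegrand k F p.1 p.2‖
      ≤ C * Real.pi ^ (-(d : ℝ)) / 2 * (κ (p.1 - p.2) * g p.1 + κ (p.1 - p.2) * g p.2) := by
    rintro ⟨z, w⟩
    have hu := bracket_pos (z - w)
    have hC : 0 ≤ C := by
      have := (norm_nonneg _).trans (h 0 0)
      simpa [bracket_zero] using this
    have h0 := fockDensity_nonneg z
    simp only [pairingIntegrand, wickIntegrand, norm_mul, norm_exp_scal, RCLike.norm_conj,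
      Complex.norm_real, hκ, hg]
    rw [Real.norm_of_nonneg h0, Real.norm_of_nonneg (by positivity)]
    set x := Real.exp (-(‖z‖ ^ 2 / 2)) * ‖F z‖ with hx
    set y := Real.exp (-(‖w‖ ^ 2 / 2)) * ‖F w‖ with hy
    have hex : ∀ v : Cd d, Real.exp (-‖v‖ ^ 2)
        = Real.exp (-(‖v‖ ^ 2 / 2)) * Real.exp (-(‖v‖ ^ 2 / 2)) := fun v => by
      rw [← Real.exp_add]; congr 1; ring
    have hinv : ∀ v : Cd d, Real.exp (‖v‖ ^ 2 / 2) * Real.exp (-(‖v‖ ^ 2 / 2)) = 1 := fun v => by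
      rw [← Real.exp_add, add_neg_cancel, Real.exp_zero]
    calc _ ≤ fockDensity z * Real.pi ^ (-(d : ℝ))
          * ((C * Real.exp (‖z - w‖ ^ 2 / 2) * (bracket (z - w) ^ decayExp d)⁻¹) * ‖F w‖
            * (Real.exp (‖z‖ ^ 2 / 2) * Real.exp (-(‖w‖ ^ 2 / 2))
              * Real.exp (-(‖z - w‖ ^ 2 / 2))) * ‖F z‖) := by
          gcongr
          exact h z w
      _ = Real.pi ^ (-(d : ℝ)) * Real.pi ^ (-(d : ℝ)) * C * (bracket (z - w) ^ decayExp d)⁻¹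
          * (x * y) * (Real.exp (‖z - w‖ ^ 2 / 2) * Real.exp (-(‖z - w‖ ^ 2 / 2)))
          * (Real.exp (‖z‖ ^ 2 / 2) * Real.exp (-(‖z‖ ^ 2 / 2))) := by
          rw [hx, hy, fockDensity, hex z]; ring
      _ ≤ Real.pi ^ (-(d : ℝ)) * Real.pi ^ (-(d : ℝ)) * C * (bracket (z - w) ^ decayExp d)⁻¹
          * ((x ^ 2 + y ^ 2) / 2) := by
          rw [hinv, hinv, mul_one, mul_one]
          gcongr
          -- `x * y ≤ (x² + y²) / 2` splits the bilinear bound into the two marginals.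
          nlinarith [sq_nonneg (x - y)]
      _ = _ := by rw [hx, hy, fockDensity, fockDensity, hex z, hex w]; ring
  have hfub : ∫ z, ∫ w, pairingIntegrand k F z w
      = ∫ p : Cd d × Cd d, pairingIntegrand k F p.1 p.2 ∂(volume.prod volume) :=
    (integral_prod _ (hk.integrable_pairingIntegrand hF)).symm
  rw [fockInner_wickOp, hfub, fockNorm_sq]
  refine (norm_integral_le_of_norm_le ((hr.add hq).const_mul _)
    (Filter.Eventually.of_forall hbound)).trans (le_of_eq ?_)
  rw [integral_const_mul]
  simp only [Pi.add_apply]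
  rw [integral_add hr hq, hrI, hqI]
  ring

/-! ### The second-order Taylor remainder of the symbol -/

theorem norm_taylor_remainder_le {φ φ' φ'' : ℝ → ℂ} (h₁ : ∀ t, HasDerivAt φ (φ' t) t)
    (h₂ : ∀ t, HasDerivAt φ' (φ'' t) t) {M : ℝ} (hM : ∀ t ∈ Set.Icc (0 : ℝ) 1, ‖φ'' t‖ ≤ M) :
    ‖φ 1 - φ 0 - φ' 0‖ ≤ M := by
  have hM0 : 0 ≤ M := (norm_nonneg _).trans (hM 0 (by simp))
  have h' : ∀ t ∈ Set.Icc (0 : ℝ) 1, ‖φ' t - φ' 0‖ ≤ M := fun t ht => by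
    refine (norm_image_sub_le_of_norm_deriv_le_segment' (fun x _ => (h₂ x).hasDerivWithinAt)
      (fun x hx => hM x ⟨hx.1, hx.2.le⟩) t ht).trans ?_
    rw [sub_zero]
    exact mul_le_of_le_one_right hM0 ht.2
  have hψ : ∀ t, HasDerivAt (fun t : ℝ => φ t - (t : ℂ) * φ' 0) (φ' t - φ' 0) t := fun t => by
    have := (h₁ t).fun_sub ((hasDerivAt_id t).ofReal_comp.mul_const (φ' 0))
    simpa using this
  have := norm_image_sub_le_of_norm_deriv_le_segment_01'
    (fun t _ => (hψ t).hasDerivWithinAt) fun t ht => h' t ⟨ht.1, ht.2.le⟩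
  refine le_trans (le_of_eq ?_) this
  congr 1
  push_cast
  ring

theorem one_add_pow_le_exp (n : ℕ) {x : ℝ} (hx : 0 ≤ x) :
    (1 + x) ^ n ≤ 2 ^ n * n.factorial * Real.exp (1 / 2) * Real.exp (x / 2) := by
  have h := Real.pow_div_factorial_le_exp (x := (1 + x) / 2) (by positivity) n
  rw [div_pow, div_div, div_le_iff₀ (by positivity)] at h
  refine h.trans (le_of_eq ?_)
  rw [add_div, Real.exp_add]
  ring

/-- On the segment from `0` to `u` the function `e^{|·|²/2} ⟨·⟩^{-2n}` is controlled by its value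
at `u`, since `(1 + s)/(1 + t² s) ≤ 1 + (s - t² s)` and the Gaussian absorbs powers of the right
side. -/
theorem exp_mul_inv_bracket_pow_le (n : ℕ) {t : ℝ} (ht : t ∈ Set.Icc (0 : ℝ) 1) (u : Cd d) :
    Real.exp (‖(t : ℂ) • u‖ ^ 2 / 2) * (bracket ((t : ℂ) • u) ^ (2 * n))⁻¹
      ≤ 2 ^ n * n.factorial * Real.exp (1 / 2)
        * (Real.exp (‖u‖ ^ 2 / 2) * (bracket u ^ (2 * n))⁻¹) := by
  have hn : ‖(t : ℂ) • u‖ ^ 2 = t ^ 2 * ‖u‖ ^ 2 := by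
    rw [norm_smul, Complex.norm_real, mul_pow, Real.norm_eq_abs, sq_abs]
  rw [pow_mul, pow_mul, bracket_sq, bracket_sq, hn]
  set s := ‖u‖ ^ 2 with hs
  have hs0 : 0 ≤ s := sq_nonneg _
  have ht1 : t ^ 2 ≤ 1 := pow_le_one₀ ht.1 ht.2
  have hx : 0 ≤ s - t ^ 2 * s := by nlinarith
  have h1 : (1 + s) ≤ (1 + t ^ 2 * s) * (1 + (s - t ^ 2 * s)) := by
    nlinarith [mul_nonneg (mul_nonneg (sq_nonneg t) hs0) hx]
  have h2 : (1 + s) ^ n ≤ (1 + t ^ 2 * s) ^ n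
      * (2 ^ n * n.factorial * Real.exp (1 / 2) * Real.exp ((s - t ^ 2 * s) / 2)) := by
    calc (1 + s) ^ n ≤ ((1 + t ^ 2 * s) * (1 + (s - t ^ 2 * s))) ^ n := by gcongr
      _ = (1 + t ^ 2 * s) ^ n * (1 + (s - t ^ 2 * s)) ^ n := mul_pow _ _ _
      _ ≤ _ := by gcongr; exact one_add_pow_le_exp n hx
  have h3 : Real.exp (t ^ 2 * s / 2) * Real.exp ((s - t ^ 2 * s) / 2) = Real.exp (s / 2) := by
    rw [← Real.exp_add]; congr 1; ring
  have hp : 0 < (1 + t ^ 2 * s) ^ n := by positivity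
  have hq : 0 < (1 + s) ^ n := by positivity
  rw [← div_eq_mul_inv, ← div_eq_mul_inv, ← mul_div_assoc, div_le_div_iff₀ hp hq]
  calc Real.exp (t ^ 2 * s / 2) * (1 + s) ^ n
      ≤ Real.exp (t ^ 2 * s / 2) * ((1 + t ^ 2 * s) ^ n
        * (2 ^ n * n.factorial * Real.exp (1 / 2) * Real.exp ((s - t ^ 2 * s) / 2))) := by gcongr
    _ = 2 ^ n * n.factorial * Real.exp (1 / 2)
        * (Real.exp (t ^ 2 * s / 2) * Real.exp ((s - t ^ 2 * s) / 2)) * (1 + t ^ 2 * s) ^ n := by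
        ring
    _ = _ := by rw [h3]

theorem apply_prodMk_zero (L : Cd d × Cd d →L[ℂ] ℂ) (u : Cd d) :
    L (u, 0) = ∑ j, u j * L (stdVec j, 0) := by
  have h : L.comp (ContinuousLinearMap.inl ℂ _ _) u
      = ∑ j, u j * L.comp (ContinuousLinearMap.inl ℂ _ _) (stdVec j) := by
    conv_lhs => rw [← sum_smul_stdVec u, map_sum]
    simp only [map_smul, smul_eq_mul]
  simpa using h

theorem hasDerivAt_comp_segment {h : Cd d × Cd d → ℂ} (hh : Differentiable ℂ h) (w ζ u : Cd d)
    (t : ℝ) : HasDerivAt (fun t : ℝ => h (w + (t : ℂ) • u, ζ))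
      (∑ j, u j * fderiv ℂ h (w + (t : ℂ) • u, ζ) (stdVec j, 0)) t := by
  rw [← apply_prodMk_zero]
  have h1 : HasDerivAt (fun t : ℝ => (w + (t : ℂ) • u, ζ)) (u, (0 : Cd d)) t := by
    refine HasDerivAt.prodMk ?_ (hasDerivAt_const t ζ)
    simpa using ((hasDerivAt_id t).ofReal_comp.smul_const u).const_add w
  exact ((hh _).hasFDerivAt.restrictScalars ℝ).comp_hasDerivAt t h1

section Symbol

variable {a : Cd d → Cd d → ℂ}

/-- The derivative `∂_{z_j} a` on the diagonal. -/
noncomputable def diagDeriv (a : Cd d → Cd d → ℂ) (j : Fin d) (w : Cd d) : ℂ :=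
  fderiv ℂ (symbolExt a) (w, conjVec w) (stdVec j, 0)

/-- The derivative `∂_{z_j} ∂̄_{w_j} a` on the diagonal. -/
noncomputable def diagDerivDerivBar (a : Cd d → Cd d → ℂ) (j : Fin d) (w : Cd d) : ℂ :=
  fderiv ℂ (fun p => fderiv ℂ (symbolExt a) p (stdVec j, 0)) (w, conjVec w) (0, stdVec j)

/-- The remainder of the first-order Taylor expansion of `a(·, w)` at `w`. -/
noncomputable def taylorRemainder (a : Cd d → Cd d → ℂ) (z w : Cd d) : ℂ :=
  a z w - a w w - ∑ j, (z - w) j * diagDeriv a j w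

theorem GardingSymbol.norm_taylorRemainder_le (ha : GardingSymbol a) (N : ℕ) :
    ∃ C : ℝ, ∀ z w, ‖taylorRemainder a z w‖
      ≤ C * Real.exp (‖z - w‖ ^ 2 / 2) * (bracket (z - w) ^ N)⁻¹ := by
  have hA := ha.isWickSymbol.contDiff
  -- Two powers of `⟨z-w⟩` are spent on the factor `|z-w|²` of the second-order term.
  choose C hC h using fun j k => ha.bound_deriv_deriv j k (2 * (N + 1))
  set K : ℝ := 2 ^ (N + 1) * (N + 1).factorial * Real.exp (1 / 2) with hK
  have hK0 : 0 ≤ K := by positivity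
  refine ⟨(∑ j, ∑ k, C j k) * K, fun z w => ?_⟩
  set u := z - w with hu
  set ζ := conjVec w with hζ
  have hub := bracket_pos u
  have hone := one_le_bracket u
  have hd1 := hasDerivAt_comp_segment (hA.differentiable (by simp)) w ζ u
  have hd2 : ∀ t : ℝ, HasDerivAt
      (fun t : ℝ => ∑ j, u j * fderiv ℂ (symbolExt a) (w + (t : ℂ) • u, ζ) (stdVec j, 0))
      (∑ j, u j * ∑ k, u k * fderiv ℂ (fun p => fderiv ℂ (symbolExt a) p (stdVec j, 0))
        (w + (t : ℂ) • u, ζ) (stdVec k, 0)) t := fun t =>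
    HasDerivAt.fun_sum fun j _ => (hasDerivAt_comp_segment
      ((contDiff_fderiv_apply hA (stdVec j, 0)).differentiable (by simp)) w ζ u t).const_mul (u j)
  have hM : ∀ t ∈ Set.Icc (0 : ℝ) 1,
      ‖∑ j, u j * ∑ k, u k * fderiv ℂ (fun p => fderiv ℂ (symbolExt a) p (stdVec j, 0))
        (w + (t : ℂ) • u, ζ) (stdVec k, 0)‖
      ≤ ∑ j, ∑ k, ‖u‖ ^ 2
        * (C j k * (K * (Real.exp (‖u‖ ^ 2 / 2) * (bracket u ^ (2 * (N + 1)))⁻¹))) := by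
    intro t ht
    refine (norm_sum_le _ _).trans (Finset.sum_le_sum fun j _ => ?_)
    rw [Finset.mul_sum]
    refine (norm_sum_le _ _).trans (Finset.sum_le_sum fun k _ => ?_)
    have hjk := h j k (w + (t : ℂ) • u) w
    rw [add_sub_cancel_left, mul_assoc] at hjk
    have hX := hjk.trans (mul_le_mul_of_nonneg_left (exp_mul_inv_bracket_pow_le (N + 1) ht u)
      (hC j k))
    rw [norm_mul, norm_mul]
    calc _ ≤ ‖u‖ * (‖u‖
          * (C j k * (K * (Real.exp (‖u‖ ^ 2 / 2) * (bracket u ^ (2 * (N + 1)))⁻¹)))) := by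
          refine mul_le_mul (norm_apply_le u j) (mul_le_mul (norm_apply_le u k) hX
            (norm_nonneg _) (norm_nonneg _)) (by positivity) (norm_nonneg _)
      _ = _ := by ring
  have hT := norm_taylor_remainder_le hd1 hd2 hM
  have heq : taylorRemainder a z w = symbolExt a (w + ((1 : ℝ) : ℂ) • u, ζ)
      - symbolExt a (w + ((0 : ℝ) : ℂ) • u, ζ)
      - ∑ j, u j * fderiv ℂ (symbolExt a) (w + ((0 : ℝ) : ℂ) • u, ζ) (stdVec j, 0) := by
    simp only [taylorRemainder, diagDeriv, eq_symbolExt a, Complex.ofReal_one, one_smul,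
      Complex.ofReal_zero, zero_smul, add_zero, hu, add_sub_cancel, hζ]
  rw [heq]
  refine hT.trans ?_
  have hfin : ‖u‖ ^ 2 * (bracket u ^ (2 * (N + 1)))⁻¹ ≤ (bracket u ^ N)⁻¹ := by
    rw [← div_eq_mul_inv, div_le_iff₀ (by positivity), inv_mul_eq_div, le_div_iff₀ (by positivity)]
    calc ‖u‖ ^ 2 * bracket u ^ N ≤ bracket u ^ 2 * bracket u ^ (2 * N) := by
          gcongr
          · exact norm_le_bracket u
          · omega
      _ = _ := by ring
  simp only [← Finset.mul_sum, ← Finset.sum_mul]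
  have hCs : 0 ≤ ∑ j, ∑ k, C j k :=
    Finset.sum_nonneg fun j _ => Finset.sum_nonneg fun k _ => hC j k
  calc _ = (∑ j, ∑ k, C j k) * K * Real.exp (‖u‖ ^ 2 / 2)
        * (‖u‖ ^ 2 * (bracket u ^ (2 * (N + 1)))⁻¹) := by ring
    _ ≤ _ := by gcongr

/-! ### The sharp Gårding inequality -/

theorem GardingSymbol.temperateKernel_diag (ha : GardingSymbol a) :
    TemperateKernel fun _ w => a w w := by
  obtain ⟨m, h⟩ := ha.bound
  obtain ⟨C, hC, h⟩ := h 0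
  exact TemperateKernel.of_right (ha.continuous.comp (continuous_id.prodMk continuous_id)) hC
    (m := m) fun w => by simpa using h w w

theorem continuous_fderiv_diag {h : Cd d × Cd d → ℂ} {n : WithTop ℕ∞} (hh : ContDiff ℂ n h)
    (hn : n ≠ 0) (v : Cd d × Cd d) : Continuous fun w : Cd d => fderiv ℂ h (w, conjVec w) v := by
  have h1 := (hh.continuous_fderiv hn).comp (continuous_id.prodMk continuous_conjVec)
  exact h1.clm_apply continuous_const

/-- The first-order Taylor term of the symbol defines the same operator as the Toeplitz operator
with the bounded symbol `-∑ ∂_{z_j} ∂̄_{w_j} a(w,w)`. -/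
theorem GardingSymbol.linear_term (ha : GardingSymbol a) :
    (TemperateKernel fun z w => ∑ j, (z - w) j * diagDeriv a j w) ∧
    (TemperateKernel fun _ w => -∑ j, diagDerivDerivBar a j w) ∧
    ∀ F : Cd d → ℂ, RapidFock F →
      wickOp (fun z w => ∑ j, (z - w) j * diagDeriv a j w) F
        = wickOp (fun _ w => -∑ j, diagDerivDerivBar a j w) F := by
  have hA := ha.isWickSymbol.contDiff
  have hA' := fun j : Fin d => contDiff_fderiv_apply hA (stdVec j, 0)
  obtain ⟨m, h⟩ := ha.bound_deriv
  have hc : ∀ j, Continuous (diagDeriv a j) := fun j => continuous_fderiv_diag hA (by simp) _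
  have k₀ : ∀ j, TemperateKernel fun _ w => diagDeriv a j w := fun j => by
    obtain ⟨C, hC, h⟩ := h j
    exact TemperateKernel.of_right (hc j) hC h
  have k₁ : ∀ j, TemperateKernel fun _ w : Cd d =>
      fderiv ℂ (fun p => fderiv ℂ (symbolExt a) p (stdVec j, 0)) (w, conjVec w) (stdVec j, 0) :=
    fun j => by
      obtain ⟨C, hC, h⟩ := ha.bound_deriv_deriv j j 0
      exact TemperateKernel.of_right (continuous_fderiv_diag (hA' j) (by simp) _) hC (m := 0)
        fun w => by simpa using h w w
  have k₂ : ∀ j, TemperateKernel fun _ w => diagDerivDerivBar a j w := fun j => by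
    obtain ⟨C, hC, h⟩ := ha.bound_deriv_derivBar j
    exact TemperateKernel.of_right (continuous_fderiv_diag (hA' j) (by simp) _) hC (m := 0)
      fun w => by rw [pow_zero, mul_one]; exact h w
  have k₃ : ∀ j, TemperateKernel fun _ w => diagDeriv a j w * conjVec w j := fun j => by
    obtain ⟨C, hC, h⟩ := h j
    have h1 := hc j
    have h2 := continuous_conjVec (d := d)
    refine TemperateKernel.of_right (by fun_prop) hC (m := m + 1) fun w => ?_
    have hw := bracket_pos w
    rw [norm_mul, pow_succ, ← mul_assoc]
    gcongr
    · exact h w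
    · exact (norm_apply_le _ j).trans ((norm_conjVec w).le.trans (norm_le_bracket w))
  refine ⟨TemperateKernel.sum _ fun j _ => (k₀ j).coord_mul j,
    (TemperateKernel.sum _ fun j _ => k₂ j).neg, fun F hF => funext fun z => ?_⟩
  have hibp : ∀ j, ∫ w, wickIntegrand (fun z w => (z - w) j * diagDeriv a j w) F z w
      = -∫ w, wickIntegrand (fun _ w => diagDerivDerivBar a j w) F z w := fun j =>
    integral_wickIntegrand_coord_mul ((hA' j).differentiable (by simp)) hF j (k₀ j) (k₁ j) (k₂ j)
      (k₃ j) z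
  unfold wickOp
  congr 1
  have e1 : ∀ w, wickIntegrand (fun z w => ∑ j, (z - w) j * diagDeriv a j w) F z w
      = ∑ j, wickIntegrand (fun z w => (z - w) j * diagDeriv a j w) F z w := fun w => by
    simp only [wickIntegrand, Finset.sum_mul]
  have e2 : ∀ w, wickIntegrand (fun _ w => -∑ j, diagDerivDerivBar a j w) F z w
      = -∑ j, wickIntegrand (fun _ w => diagDerivDerivBar a j w) F z w := fun w => by
    simp only [wickIntegrand, Finset.sum_mul, neg_mul]
  simp only [e1, e2]
  rw [integral_finsetSum _ fun j _ => ((k₀ j).coord_mul j).integrable_wickIntegrand hF z,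
    integral_neg, integral_finsetSum _ fun j _ => (k₂ j).integrable_wickIntegrand hF z,
    ← Finset.sum_neg_distrib]
  exact Finset.sum_congr rfl fun j _ => hibp j

/-- A Wick operator differs from the Toeplitz operator with symbol `a(w,w)` by a bounded form. -/
theorem GardingSymbol.norm_fockInner_sub_toeplitz_le (ha : GardingSymbol a) :
    ∃ B : ℝ, 0 ≤ B ∧ ∀ F : Cd d → ℂ, RapidFock F →
      ‖fockInner (wickOp a F) F - fockInner (wickOp (fun _ w => a w w) F) F‖
        ≤ B * fockNorm F ^ 2 := by
  obtain ⟨kL, kE, hLE⟩ := ha.linear_term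
  have kD := ha.temperateKernel_diag
  have kR : TemperateKernel (taylorRemainder a) := by
    have := (ha.temperateKernel.add kD.neg).add kL.neg
    simp only [← sub_eq_add_neg] at this
    exact this
  obtain ⟨C, hC⟩ := ha.norm_taylorRemainder_le (decayExp d)
  choose E hE0 hE using ha.bound_deriv_derivBar
  set S := C * Real.pi ^ (-(d : ℝ)) * ∫ u : Cd d, (bracket u ^ decayExp d)⁻¹ with hS
  have hsplit : a = fun z w => a w w
      + (∑ j, (z - w) j * diagDeriv a j w + taylorRemainder a z w) := by
    funext z w
    simp only [taylorRemainder]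
    ring
  refine ⟨∑ j, E j + |S|, add_nonneg (Finset.sum_nonneg fun j _ => hE0 j) (abs_nonneg S),
    fun F hF => ?_⟩
  have h1 : fockInner (wickOp a F) F = fockInner (wickOp (fun _ w => a w w) F) F
      + (fockInner (wickOp (fun _ w => -∑ j, diagDerivDerivBar a j w) F) F
        + fockInner (wickOp (taylorRemainder a) F) F) := by
    conv_lhs => rw [hsplit]
    rw [fockInner_wickOp_add kD (kL.add kR) hF, fockInner_wickOp_add kL kR hF, hLE F hF]
  rw [h1, add_sub_cancel_left, add_mul]
  refine (norm_add_le _ _).trans (add_le_add ?_ ?_)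
  · refine kE.norm_toeplitz_le (fun w => ?_) hF
    rw [norm_neg]
    exact (norm_sum_le _ _).trans (Finset.sum_le_sum fun j _ => hE j w)
  · refine (kR.norm_fockInner_le hC hF).trans ?_
    gcongr
    exact le_abs_self S

end Symbol

end WickCalculus

/-- Sharp Gårding inequality for Wick operators with symbols in the Shubin-type class.
The pairing in `A²` is meaningful: for `F` in the Bargmann image of the Schwartz space, the
integral defining the operator converges absolutely at every point, and both `F` and its image
lie in `A²`. -/
theorem theorem4p4 (d : ℕ) (ρ : ℝ) (hρ : 0 < ρ)
    (a₀ : WickCalculus.Cd d → WickCalculus.Cd d → ℂ)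
    (ha₀ : a₀ ∈ WickCalculus.ShubinWickClass d ρ
      (fun z => WickCalculus.bracket z ^ (2 * ρ)))
    (C₀ : ℝ) (hC₀ : 0 ≤ C₀)
    (hreal : ∀ w, (a₀ w w).im = 0)
    (hlower : ∀ w, -C₀ ≤ (a₀ w w).re) :
    (∀ F ∈ WickCalculus.bargmannSchwartz d,
      WickCalculus.MemFock F ∧
      (∀ z, Integrable (WickCalculus.wickIntegrand a₀ F z)) ∧
      WickCalculus.MemFock (WickCalculus.wickOp a₀ F)) ∧
    ∃ C : ℝ, 0 ≤ C ∧
      ∀ F ∈ WickCalculus.bargmannSchwartz d,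
        -C * WickCalculus.fockNorm F ^ 2
            ≤ (WickCalculus.fockInner (WickCalculus.wickOp a₀ F) F).re ∧
        |(WickCalculus.fockInner (WickCalculus.wickOp a₀ F) F).im|
            ≤ C * WickCalculus.fockNorm F ^ 2 := by
  have ha := WickCalculus.gardingSymbol_of_mem hρ ha₀
  refine ⟨fun F hF => ?_, ?_⟩
  · have hR := WickCalculus.rapidFock_of_mem_bargmannSchwartz hF
    exact ⟨hR.memFock, ha.temperateKernel.integrable_wickIntegrand hR,
      (ha.rapidFock_wickOp hR).memFock⟩
  obtain ⟨B, hB, hle⟩ := ha.norm_fockInner_sub_toeplitz_le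
  refine ⟨C₀ + B, add_nonneg hC₀ hB, fun F hF => ?_⟩
  have hR := WickCalculus.rapidFock_of_mem_bargmannSchwartz hF
  obtain ⟨hre, him⟩ := ha.temperateKernel_diag.toeplitz_real hreal hlower hR
  have hre' := (Complex.abs_re_le_norm _).trans (hle F hR)
  have him' := (Complex.abs_im_le_norm _).trans (hle F hR)
  rw [Complex.sub_re, abs_le] at hre'
  rw [Complex.sub_im, him, sub_zero] at him'
  constructor
  · linarith [hre'.1]
  · nlinarith [mul_nonneg hC₀ (sq_nonneg (WickCalculus.fockNorm F))]
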